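/- **Setting.** Let $E$ be a finite ground set with $|E|=n$, let $\mathcal M$ be a matroid on $E$ of rank $r$ with matroid polytope $\mathcal P=\mathrm{conv}\{\mathbf 1_I: I \text{ independent}\}$, and let $f_1,\dots,f_N:2^E\to\mathbb R$ be monotone submodular functions with $f_i(\emptyset)=0$. Let $(p_i)_{i\le N}$ be a probability vector and $F=\sum_i p_i f_i$. For a set function $f$ let $\widehat f$ be its multilinear extension, $m_f=\max_{e\in E}f(\{e\})$, and let $\mathtt{OPT}=\max_{\mathbf x\in\mathcal P}\widehat F(\mathbf x)$. Write $R\sim\mathbf x$ for a random set that contains each $e$ independently with probability $\mathbf x(e)$ (with certainty if $\mathbf x(e)>1$), and, for $\mathbf x\ge \mathbf 0$ outside $[0,1]^E$, read $\nabla\widehat f(\mathbf x)$ as $\nabla \widehat f(\min(\mathbf x,\mathbf 1))$, the vector of expected marginal values under $R\sim\mathbf x$. **Algorithm (FedCG+).** The parameters are integers $\tau,T,K\ge1$ with $\tau\mid T$, an integer $m$, and $\eta\in(0,\tau/T]$. Start with $\mathbf x_0=\mathbf 0$. In each round $t=0,\dots,T/\tau-1$ the server draws $K$ clients independently with replacement,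 client $i$ with probability $p_i$, independently of the clients' samples, and sends $\mathbf x_t$ to them. Client $i$ sets $\mathbf x_i^{(t,0)}=\mathbf x_t$ and, for $j=0,\dots,\tau-1$, draws independent $R_1,\dots,R_m\sim\mathbf x_i^{(t,j)}$, forms the gradient estimate $\mathbf g(e)=\frac1m\sum_{l}\big(f_i(R_l\cup\{e\})-f_i(R_l\setminus\{e\})\big)$, picks $\mathbf v\in\arg\max_{\mathbf w\in\mathcal P}\langle \mathbf w,\mathbf g\rangle$ (deterministic tie-breaking, which may depend on $t,i,j$) and sets $\mathbf x_i^{(t,j+1)}=\mathbf x_i^{(t,j)}+\mathbf v/\tau$. An active client sends back $\Delta_i=\mathbf x_i^{(t,\tau)}-\mathbf x_i^{(t,0)}$, and $\mathbf x_{t+1}=\mathbf x_t+\eta\Delta$, where $\Delta$ is the average of $\Delta_i$ over the multiset of $K$ drawn clients. The output is $\mathbf x_{T/\tau}$. **Assumptions.** Let $\gamma_t$ and $L_t\ge0$ ($0\le t<T/\tau$) be numbers such that almost surely, for every round $t$, every client $i$ (active or not; an inactive client is given the local models it would compute) and every $0\le j<\tau$, $$\|\nabla\widehat f_i(\mathbf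 x_t)-\nabla\widehat F(\mathbf x_t)\|_\infty\le\gamma_t,\qquad \|\nabla\widehat f_i(\mathbf x_i^{(t,j)})-\nabla\widehat f_i(\mathbf x_t)\|_2\le L_t\|\mathbf x_i^{(t,j)}-\mathbf x_t\|_2 .$$ Put $D=\sum_{t}\gamma_t$ and $Q=\sum_t L_t$, the sums being over the rounds $0\le t<T/\tau$. **Theorem.** For every $n$ and $B$ there is a constant $C>0$, depending only on $n$ and $B$, such that the following holds whenever $m_{f_i}\le B$ for all $i$. Let $\sigma,\delta>0$, $0<\eta\le\tau/T$ and $m\ge C\log(2TK/\delta)/\sigma^2$. Then FedCG+ always returns a point $\mathbf x_{T/\tau}\in\mathcal P$, and with probability at least $1-\delta$ $$\big(1-(1-\eta)^{T/\tau}\big)\mathtt{OPT}\le \widehat F(\mathbf x_{T/\tau})+\frac{T\eta^2r^2m_F}{2\tau}+\eta rD+2\sigma r+2\eta r^{1.5}Q+\frac{\sqrt T\,\big(6\eta rD+2\sigma r+2\eta r^{1.5}Q\big)}{\sqrt{K\tau\delta}} .$$ In particular, for $\eta=\tau/T$, with probability at least $1-\delta$ $$\Big(1-\frac1{\mathrm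 e}\Big)\mathtt{OPT}\le\widehat F(\mathbf x_{T/\tau})+\frac{\tau r^2m_F}{2T}+\frac{rD\tau}{T}+2\sigma r\Big(1+\frac{\sqrt\tau}{\sqrt{KT\delta}}\Big)+\frac{2r^{1.5}Q\tau}{T}+\frac{\sqrt\tau\,(6Dr+2r^{1.5}Q)}{\sqrt{TK\delta}} .$$ Moreover, if the chosen maximizers $\mathbf v$ are vertices of $\mathcal P$ (indicator vectors of independent sets), the messages in both directions can be encoded by prefix-free binary codes so that every client exchanges at most $b=n\big(\lceil\log_2(\tau+1)\rceil+\lceil\log_2(TK+1)\rceil\big)=\tilde O(n)$ bits with the server per round, hence at most $K\,(T/\tau)\,b=\tilde O(KTn/\tau)$ bits are exchanged in total. -/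

import Mathlib

namespace FedCG

noncomputable section

/-! ### Set functions, multilinear extension, matroid polytope -/

section SetFunctions

variable {E : Type*} [Fintype E] [DecidableEq E]

/-- Submodularity: diminishing marginal returns. -/
def IsSubmodular (f : Finset E → ℝ) : Prop :=
  ∀ (S T : Finset E) (e : E), S ⊆ T → e ∉ T →
    f (insert e T) - f T ≤ f (insert e S) - f S

/-- The multilinear extension of `f`, as a polynomial function on `E → ℝ`
(it is used on `[0,1]^E`). -/
def multilinearExt (f : Finset E → ℝ) (x : E → ℝ) : ℝ :=
  ∑ S : Finset E, f S * ((∏ e ∈ S, x e) * ∏ e ∈ Sᶜ, (1 - x e))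

/-- The gradient of the multilinear extension: the vector of its partial derivatives. -/
def multilinearGrad (f : Finset E → ℝ) (x : E → ℝ) : E → ℝ :=
  fun e => deriv (fun s : ℝ => multilinearExt f (Function.update x e s)) (x e)

/-- The matroid polytope: the convex hull of the indicator vectors of the independent sets. -/
def matroidPolytope (M : Matroid E) : Set (E → ℝ) :=
  convexHull ℝ {v | ∃ I : Set E, M.Indep I ∧ v = I.indicator 1}

/-- `m_f`, the largest value of `f` on a singleton (`0` on an empty ground set). -/
def maxSingleton (f : Finset E → ℝ) : ℝ := ⨆ e : E, f {e}

/-- Coordinatewise projection to `[0,1]`; the identity on `[0,1]^E`. -/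
def clip (x : E → ℝ) : E → ℝ := fun e => max 0 (min 1 (x e))

/-- The law of `R ∼ x`: each `e` belongs to `R` independently with probability `x e`. A
coordinate `x e > 1` means that `e` is put into `R` with certainty. -/
def setPMF (x : E → ℝ) : PMF (Finset E) :=
  PMF.ofFintype
    (fun S => (∏ e ∈ S, ENNReal.ofReal (clip x e)) * ∏ e ∈ Sᶜ, ENNReal.ofReal (1 - clip x e))
    (by
      have h := Finset.prod_add (fun e => ENNReal.ofReal (clip x e))
        (fun e => ENNReal.ofReal (1 - clip x e)) (Finset.univ : Finset E)
      rw [Finset.powerset_univ] at h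
      simp only [← Finset.compl_eq_univ_sdiff] at h
      rw [← h]
      refine Finset.prod_eq_one fun e _ => ?_
      have h0 : 0 ≤ clip x e := le_max_left _ _
      have h1 : clip x e ≤ 1 := max_le zero_le_one (min_le_left _ _)
      rw [← ENNReal.ofReal_add h0 (by linarith)]
      simp)

/-- The estimate of the gradient from `m` sampled sets: the empirical mean of the marginal
values `f (R ∪ {e}) - f (R \ {e})`. -/
def gradEst (f : Finset E → ℝ) {m : ℕ} (ζ : Fin m → Finset E) : E → ℝ :=
  fun e => (∑ l, (f (insert e (ζ l)) - f ((ζ l).erase e))) / m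

end SetFunctions

/-- The joint law of independent variables with laws `q i`. -/
def piPMF {κ : Type*} [Fintype κ] [DecidableEq κ] {α : κ → Type*} [∀ i, Fintype (α i)]
    (q : ∀ i, PMF (α i)) : PMF (∀ i, α i) :=
  PMF.ofFintype (fun a => ∏ i, q i (a i)) (by
    rw [← Fintype.prod_sum]
    refine Finset.prod_eq_one fun i _ => ?_
    rw [← tsum_fintype (L := .unconditional _)]
    exact (q i).tsum_coe)

/-! ### The algorithm -/

/-- The input of the algorithm: the clients' functions `f i`, their weights `p i` (a
probability distribution on the clients), the total number `T` of local steps, the number `τ`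
of local steps per communication round, the number `K` of sampled clients, the number `m` of
sets sampled per gradient estimate, the server's learning rate `η`, and the linear
maximization oracle `lmo ρ i j` of client `i` at local step `j` of round `ρ` (ties in the
argmax may be broken arbitrarily). -/
structure Input (E ι : Type*) where
  f : ι → Finset E → ℝ
  p : PMF ι
  T : ℕ
  τ : ℕ
  K : ℕ
  m : ℕ
  η : ℝ
  lmo : ℕ → ι → ℕ → (E → ℝ) → (E → ℝ)

namespace Input

variable {E ι : Type*} [Fintype E] [DecidableEq E] [Fintype ι] [DecidableEq ι]

/-- The random draws of one round: the `K` clients picked by the server, and for every client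
and every local step, `m` subsets of `E`. The draws of a client that is not picked do not
influence the server; they define the local models that this client would compute. -/
abbrev RoundDraw (S : Input E ι) : Type _ :=
  (Fin S.K → ι) × (ι → Fin S.τ → Fin S.m → Finset E)

/-- The number of communication rounds. -/
def rounds (S : Input E ι) : ℕ := S.T / S.τ

/-- The random draws of a whole run. -/
abbrev Draw (S : Input E ι) : Type _ := Fin S.rounds → S.RoundDraw

/-- The objective `F = ∑ i, p i * f i`. -/
def F (S : Input E ι) : Finset E → ℝ := fun A => ∑ i, (S.p i).toReal * S.f i A

/-- The local model of client `i` in round `ρ` after `j` local steps that start from the server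
model `x` and use the sampled sets `ζ 0, …, ζ (j - 1)` (it stays constant when the draws are
used up). -/
def localModel (S : Input E ι) (ρ : ℕ) (i : ι) (x : E → ℝ) {n : ℕ}
    (ζ : Fin n → Fin S.m → Finset E) : ℕ → (E → ℝ)
  | 0 => x
  | j + 1 =>
    if h : j < n then
      S.localModel ρ i x ζ j + (1 / (S.τ : ℝ)) • S.lmo ρ i j (gradEst (S.f i) (ζ ⟨j, h⟩))
    else S.localModel ρ i x ζ j

/-- The law of the sets that client `i` samples in its first `n` local steps of round `ρ`: in
each step, `m` independent sets drawn according to the current local model. -/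
def localPMF (S : Input E ι) (ρ : ℕ) (i : ι) (x : E → ℝ) :
    (n : ℕ) → PMF (Fin n → Fin S.m → Finset E)
  | 0 => PMF.pure Fin.elim0
  | n + 1 => (S.localPMF ρ i x n).bind fun ζ =>
      (piPMF fun _ : Fin S.m => setPMF (S.localModel ρ i x ζ n)).map fun z =>
        Fin.snoc (α := fun _ => Fin S.m → Finset E) ζ z

/-- The law of the draws of round `ρ` from the server model `x`: the server picks a client with
probabilities `p`, independently `K` times, and the clients sample independently of each other
and of the server's choice. -/
def roundPMF (S : Input E ι) (ρ : ℕ) (x : E → ℝ) : PMF S.RoundDraw :=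
  (piPMF fun _ : Fin S.K => S.p).bind fun A =>
    (piPMF fun i => S.localPMF ρ i x S.τ).map fun ζ => (A, ζ)

/-- The local model change of client `i` in round `ρ`. -/
def localChange (S : Input E ι) (ρ : ℕ) (i : ι) (x : E → ℝ) (d : S.RoundDraw) : E → ℝ :=
  S.localModel ρ i x (d.2 i) S.τ - S.localModel ρ i x (d.2 i) 0

/-- The aggregated update: the average over the multiset of the `K` picked clients. -/
def aggregate (S : Input E ι) (ρ : ℕ) (x : E → ℝ) (d : S.RoundDraw) : E → ℝ :=
  (1 / (S.K : ℝ)) • ∑ k, S.localChange ρ (d.1 k) x d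

/-- The server model after `ρ` rounds, as a function of the draws (it stays constant when the
draws are used up). -/
def serverModel (S : Input E ι) {n : ℕ} (ω : Fin n → S.RoundDraw) : ℕ → (E → ℝ)
  | 0 => 0
  | ρ + 1 =>
    if h : ρ < n then
      S.serverModel ω ρ + S.η • S.aggregate ρ (S.serverModel ω ρ) (ω ⟨ρ, h⟩)
    else S.serverModel ω ρ

/-- The law of the draws of the first `n` rounds. -/
def historyPMF (S : Input E ι) : (n : ℕ) → PMF (Fin n → S.RoundDraw)
  | 0 => PMF.pure Fin.elim0
  | n + 1 => (S.historyPMF n).bind fun ω =>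
      (S.roundPMF n (S.serverModel ω n)).map fun d =>
        Fin.snoc (α := fun _ => S.RoundDraw) ω d

/-- The law of the draws of a whole run. -/
def runPMF (S : Input E ι) : PMF S.Draw := S.historyPMF S.rounds

/-- The local model of client `i` after `j` local steps of round `ρ` of the run `ω`. -/
def model (S : Input E ι) (ω : S.Draw) (ρ : Fin S.rounds) (i : ι) (j : ℕ) : E → ℝ :=
  S.localModel ρ i (S.serverModel ω ρ) ((ω ρ).2 i) j

/-- The message that client `i` sends in round `ρ` of the run `ω` if it is active. -/
def message (S : Input E ι) (ω : S.Draw) (ρ : Fin S.rounds) (i : ι) : E → ℝ :=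
  S.localChange ρ i (S.serverModel ω ρ) (ω ρ)

/-- The point returned by the algorithm. -/
def output (S : Input E ι) (ω : S.Draw) : E → ℝ := S.serverModel ω S.rounds

/-! ### Quantities and assumptions of the analysis -/

/-- The maximum of the multilinear extension of the objective over the matroid polytope. -/
def opt (S : Input E ι) (M : Matroid E) : ℝ :=
  sSup (multilinearExt S.F '' matroidPolytope M)

/-- The oracle maximizes linear functions with nonnegative coefficients over the polytope. -/
def IsLinearMaximizer (S : Input E ι) (M : Matroid E) : Prop :=
  ∀ (ρ : ℕ) (i : ι) (j : ℕ) (g : E → ℝ), 0 ≤ g →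
    S.lmo ρ i j g ∈ matroidPolytope M ∧
      ∀ w ∈ matroidPolytope M, w ⬝ᵥ g ≤ S.lmo ρ i j g ⬝ᵥ g

/-- The oracle answers with vertices of the polytope. -/
def ReturnsVertices (S : Input E ι) (M : Matroid E) : Prop :=
  ∀ (ρ : ℕ) (i : ι) (j : ℕ) (g : E → ℝ), 0 ≤ g →
    ∃ I : Set E, M.Indep I ∧ S.lmo ρ i j g = I.indicator 1

/-- Bounded heterogeneity, in the sup norm of `E → ℝ`, at the server model at the beginning of
each round. -/
def BoundedHeterogeneity (S : Input E ι) (γ : ℕ → ℝ) : Prop :=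
  ∀ ω ∈ S.runPMF.support, ∀ (ρ : Fin S.rounds) (i : ι),
    ‖multilinearGrad (S.f i) (S.serverModel ω ρ) - multilinearGrad S.F (S.serverModel ω ρ)‖
      ≤ γ ρ

/-- Local Lipschitz constants: in round `ρ` the gradient at every local model differs from the
gradient at the server model by at most `L ρ` times the distance of the two models, in Euclidean
norms. The gradient at a local model `y` is read as `multilinearGrad (f i) (clip y)`, the
expected marginal values under `R ∼ y`; for `y` in `[0,1]^E` this is `multilinearGrad (f i) y`. -/
def LocallyLipschitz (S : Input E ι) (L : ℕ → ℝ) : Prop :=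
  (∀ ρ, 0 ≤ L ρ) ∧
  ∀ ω ∈ S.runPMF.support, ∀ (ρ : Fin S.rounds) (i : ι), ∀ j < S.τ,
    ‖WithLp.toLp 2 (multilinearGrad (S.f i) (clip (S.model ω ρ i j)) -
        multilinearGrad (S.f i) (S.serverModel ω ρ))‖
      ≤ L ρ * ‖WithLp.toLp 2 (S.model ω ρ i j - S.serverModel ω ρ)‖

/-- `enc` is a prefix-free (in particular injective) binary code for the messages in `X`. -/
def IsPrefixCode {X : Type*} (A : Set X) (enc : X → List Bool) : Prop :=
  ∀ u ∈ A, ∀ v ∈ A, enc u <+: enc v → u = v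

/-- The number of bits exchanged with client `i` in round `ρ`: if `i` is active, it receives
the server model, encoded by `down`, and sends its local model change, encoded by `up`. -/
def bits (S : Input E ι) (down up : (E → ℝ) → List Bool) (ω : S.Draw)
    (ρ : Fin S.rounds) (i : ι) : ℕ :=
  if ∃ k, (ω ρ).1 k = i then
    (down (S.serverModel ω ρ)).length + (up (S.message ω ρ i)).length
  else 0

end Input

end

end FedCG

/-!
The optimality gap `OPT - F (x t)` contracts by the factor `1 - η` in every round, up to errors.
Indeed the extension is concave along nonnegative directions, so the gap is at most the linear gain
`⟨w, ∇F (x t)⟩` of the best direction `w` (`opt_le_add_bestDirection`), and its gradient decreases at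
rate at most `maxSingleton F`, so a step `η Δ` loses at most `η² r² maxSingleton F / 2` against its
linear gain (`multilinearExt_add_ge`). It remains to compare `⟨Δ, ∇F (x t)⟩` with the gain of `w`.

A client whose estimates are all within `σ` of the true gradients follows directions that are as good
as `w` for its own function, up to `2σr` for the estimates and `2Lr` for the drift of the local
models; replacing the gradient of its function by that of `F` costs `γr`
(`bestDirection_sub_le_gain`). By Hoeffding's inequality and a union bound all clients that are
*active* do have accurate estimates (`prob_historyInaccurate_le`); a union bound over all clients
would make the number of samples depend on their number. Therefore the gain of each client is
truncated from below at the value that accuracy guarantees (`truncGain`): this changes nothing for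
the active clients on the good event, while the truncated gains of all clients lie in an interval of
length `2r (γ + σ + L)` and have mean at least `⟨w, ∇F (x t)⟩ - r (γ + 2σ + 2L)`.

The difference between the mean of the truncated gains and their average over the sampled clients is
centred given the past and the clients' samples, since the server samples independently. So the
noise of different rounds is uncorrelated, the second moment of its discounted sum is at most the sum
of the second moments of the rounds (`expect_noiseSum_sq_le`), and Chebyshev's inequality gives the remaining error term
(`one_sub_le_prob_opt_le`).

For the communication, vertices have coordinates in `{0, 1}`, so all coordinates of a message are
multiples of one fixed number by bounded natural numbers, and a code of fixed length does
(`exists_prefixCode`).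
-/

set_option linter.unusedSectionVars false

namespace FedCG

open Finset

/-! ### Expectations over finite probability spaces -/

section Expectation

variable {α β : Type*} [Fintype α] [Fintype β]

/-- The expectation of a real random variable on a finite probability space. -/
noncomputable def expect (q : PMF α) (g : α → ℝ) : ℝ := ∑ a, (q a).toReal * g a

theorem sum_toReal_eq_one (q : PMF α) : ∑ a, (q a).toReal = 1 := by
  rw [← ENNReal.toReal_sum fun a _ => q.apply_ne_top a, ← tsum_fintype (L := .unconditional _),
    q.tsum_coe, ENNReal.toReal_one]

theorem expect_const (q : PMF α) (c : ℝ) : expect q (fun _ => c) = c := by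
  rw [expect, ← sum_mul, sum_toReal_eq_one, one_mul]

theorem expect_add (q : PMF α) (g h : α → ℝ) :
    expect q (fun a => g a + h a) = expect q g + expect q h := by
  simp only [expect, mul_add, sum_add_distrib]

theorem expect_const_mul (q : PMF α) (c : ℝ) (g : α → ℝ) :
    expect q (fun a => c * g a) = c * expect q g := by
  simp only [expect, mul_sum]
  exact sum_congr rfl fun a _ => by ring

theorem expect_sub (q : PMF α) (g h : α → ℝ) :
    expect q (fun a => g a - h a) = expect q g - expect q h := by
  simp only [expect, mul_sub, sum_sub_distrib]

theorem expect_sum {κ : Type*} (q : PMF α) (s : Finset κ) (g : κ → α → ℝ) :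
    expect q (fun a => ∑ k ∈ s, g k a) = ∑ k ∈ s, expect q (g k) := by
  simp only [expect, mul_sum]
  exact sum_comm

theorem expect_mono_support {q : PMF α} {g h : α → ℝ} (H : ∀ a ∈ q.support, g a ≤ h a) :
    expect q g ≤ expect q h := by
  refine sum_le_sum fun a _ => ?_
  by_cases ha : q a = 0
  · simp [ha]
  · exact mul_le_mul_of_nonneg_left (H a ((q.mem_support_iff a).2 ha)) ENNReal.toReal_nonneg

theorem expect_mono {q : PMF α} {g h : α → ℝ} (H : ∀ a, g a ≤ h a) :
    expect q g ≤ expect q h :=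
  expect_mono_support fun a _ => H a

theorem expect_comm (q : PMF α) (q' : PMF β) (g : α → β → ℝ) :
    expect q (fun a => expect q' (g a)) = expect q' (fun b => expect q fun a => g a b) := by
  simp only [expect, mul_sum]
  rw [sum_comm]
  exact sum_congr rfl fun b _ => sum_congr rfl fun a _ => by ring

theorem expect_pure (a : α) (g : α → ℝ) : expect (PMF.pure a) g = g a := by
  classical
  rw [expect, sum_eq_single a]
  · simp
  · intro b _ hb
    simp [PMF.pure_apply, hb]
  · simp

theorem expect_bind (q : PMF α) (k : α → PMF β) (g : β → ℝ) :
    expect (q.bind k) g = expect q fun a => expect (k a) g := by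
  have h : ∀ b, ((q.bind k) b).toReal = ∑ a, (q a).toReal * (k a b).toReal := by
    intro b
    rw [PMF.bind_apply, tsum_fintype, ENNReal.toReal_sum]
    · simp only [ENNReal.toReal_mul]
    · exact fun a _ => ENNReal.mul_ne_top (q.apply_ne_top a) ((k a).apply_ne_top b)
  simp only [expect, h, sum_mul, mul_sum]
  rw [sum_comm]
  exact sum_congr rfl fun b _ => sum_congr rfl fun a _ => by ring

theorem expect_map (q : PMF α) (k : α → β) (g : β → ℝ) :
    expect (q.map k) g = expect q fun a => g (k a) := by
  rw [← PMF.bind_pure_comp, expect_bind]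
  simp only [Function.comp_apply, expect_pure]

/-- The real-valued probability of an event. -/
noncomputable def prob (q : PMF α) (s : Set α) : ℝ := expect q (s.indicator 1)

theorem indicator_one_nonneg (s : Set α) (a : α) : (0 : ℝ) ≤ s.indicator 1 a :=
  Set.indicator_nonneg (fun _ _ => zero_le_one) a

theorem indicator_one_le_one (s : Set α) (a : α) : s.indicator 1 a ≤ (1 : ℝ) :=
  Set.indicator_le_self' (fun _ _ => zero_le_one) a

theorem prob_mono (q : PMF α) {s t : Set α} (h : s ⊆ t) : prob q s ≤ prob q t :=
  expect_mono fun a => Set.indicator_le_indicator_of_subset h (fun _ => zero_le_one) a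

theorem prob_union_le (q : PMF α) (s t : Set α) : prob q (s ∪ t) ≤ prob q s + prob q t := by
  rw [prob, prob, prob, ← expect_add]
  refine expect_mono fun a => ?_
  have hs := indicator_one_nonneg s a
  have ht := indicator_one_nonneg t a
  by_cases h1 : a ∈ s
  · have := indicator_one_le_one (s ∪ t) a
    rw [Set.indicator_of_mem h1, Pi.one_apply]
    linarith
  · by_cases h2 : a ∈ t
    · have := indicator_one_le_one (s ∪ t) a
      rw [Set.indicator_of_mem h2, Pi.one_apply]
      linarith
    · rw [Set.indicator_of_notMem (by simp [h1, h2])]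
      linarith

theorem prob_iUnion_le {κ : Type*} [Fintype κ] (q : PMF α) (s : κ → Set α) :
    prob q (⋃ k, s k) ≤ ∑ k, prob q (s k) := by
  simp only [prob]
  rw [← expect_sum]
  refine expect_mono fun a => ?_
  by_cases h : a ∈ ⋃ k, s k
  · obtain ⟨k, hk⟩ := Set.mem_iUnion.1 h
    rw [Set.indicator_of_mem h]
    refine le_trans ?_ (single_le_sum (f := fun k => (s k).indicator (1 : α → ℝ) a)
      (fun k _ => indicator_one_nonneg (s k) a) (mem_univ k))
    simp only [Set.indicator_of_mem hk, le_refl]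
  · rw [Set.indicator_of_notMem h]
    exact sum_nonneg fun k _ => indicator_one_nonneg (s k) a

/-- The union bound for one more step of a random process. -/
theorem prob_bind_map_le {γ : Type*} [Fintype γ] (q : PMF α) (k : α → PMF β) (h : α → β → γ)
    {s : Set γ} {s' : Set α} {t : α → Set β} {ε : ℝ}
    (H : ∀ a b, h a b ∈ s → a ∈ s' ∨ b ∈ t a) (ht : ∀ a, prob (k a) (t a) ≤ ε) :
    prob (q.bind fun a => (k a).map (h a)) s ≤ prob q s' + ε := by
  rw [prob, expect_bind, prob, ← expect_const q ε, ← expect_add]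
  refine expect_mono fun a => ?_
  rw [expect_map]
  by_cases ha : a ∈ s'
  · have h0 : 0 ≤ ε := by
      refine le_trans ?_ (ht a)
      rw [← expect_const (k a) 0]
      exact expect_mono fun b => indicator_one_nonneg _ b
    rw [Set.indicator_of_mem ha, Pi.one_apply]
    refine (expect_mono (h := fun _ => 1) fun b => indicator_one_le_one s _).trans ?_
    rw [expect_const]
    linarith
  · rw [Set.indicator_of_notMem ha, zero_add]
    refine le_trans (expect_mono fun b => ?_) (ht a)
    by_cases hb : h a b ∈ s
    · rw [Set.indicator_of_mem ((H a b hb).resolve_left ha)]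
      exact indicator_one_le_one _ _
    · rw [Set.indicator_of_notMem hb]
      exact indicator_one_nonneg _ _

theorem ofReal_le_toOuterMeasure (q : PMF α) (s : Set α) {c : ℝ} (h : c ≤ prob q s) :
    ENNReal.ofReal c ≤ q.toOuterMeasure s := by
  refine ENNReal.ofReal_le_of_le_toReal (h.trans_eq ?_)
  rw [PMF.toOuterMeasure_apply_fintype, ENNReal.toReal_sum]
  · refine sum_congr rfl fun a _ => ?_
    by_cases ha : a ∈ s <;> simp [ha]
  · intro a _
    by_cases ha : a ∈ s <;> simp [ha, q.apply_ne_top a]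

/-- The mean minimizes the mean squared deviation, so the variance of a variable with values in
an interval of length `R` is at most `R ^ 2 / 4`. -/
theorem expect_sq_sub_mean_le (q : PMF α) (Y : α → ℝ) {u R : ℝ}
    (hY : ∀ a, u - R ≤ Y a ∧ Y a ≤ u) :
    expect q (fun a => (expect q Y - Y a) ^ 2) ≤ R ^ 2 / 4 := by
  set μ := expect q Y with hμ
  have h1 : expect q (fun a => (Y a - (u - R / 2)) ^ 2) ≤ R ^ 2 / 4 := by
    rw [← expect_const q (R ^ 2 / 4)]
    refine expect_mono fun a => ?_
    nlinarith [(hY a).1, (hY a).2]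
  have h2 : expect q (fun a => (Y a - (u - R / 2)) ^ 2)
      = expect q (fun a => (μ - Y a) ^ 2) + (μ - (u - R / 2)) ^ 2 := by
    have : (fun a => (Y a - (u - R / 2)) ^ 2) = fun a =>
        ((μ - Y a) ^ 2 + 2 * (μ - (u - R / 2)) * Y a)
          + ((u - R / 2) ^ 2 - μ ^ 2) := by
      funext a; ring
    rw [this, expect_add, expect_add, expect_const_mul, expect_const, ← hμ]
    ring
  nlinarith [sq_nonneg (μ - (u - R / 2))]

end Expectation

section Product

variable {κ : Type*} [Fintype κ] [DecidableEq κ] {α : κ → Type*} [∀ i, Fintype (α i)]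

theorem expect_piPMF_prod (q : ∀ i, PMF (α i)) (g : ∀ i, α i → ℝ) :
    expect (piPMF q) (fun a => ∏ i, g i (a i)) = ∏ i, expect (q i) (g i) := by
  simp only [expect, piPMF, PMF.ofFintype_apply, ENNReal.toReal_prod, ← prod_mul_distrib]
  rw [Fintype.prod_sum]

theorem expect_piPMF_eval (q : ∀ i, PMF (α i)) (i : κ) (g : α i → ℝ) :
    expect (piPMF q) (fun a => g (a i)) = expect (q i) g := by
  have h := expect_piPMF_prod q (Function.update (fun _ _ => 1) i g)
  rw [← mul_prod_erase _ _ (mem_univ i), prod_eq_one (s := univ.erase i)] at h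
  · rw [Function.update_self, mul_one] at h
    rw [← h]
    congr 1
    funext a
    rw [← mul_prod_erase _ _ (mem_univ i), prod_eq_one (s := univ.erase i)]
    · simp
    · intro j hj
      rw [Function.update_of_ne (ne_of_mem_erase hj)]
  · intro j hj
    rw [Function.update_of_ne (ne_of_mem_erase hj)]
    exact expect_const _ _

theorem expect_piPMF_mul_of_ne {β : Type*} [Fintype β] (q : PMF β) (U : β → ℝ)
    (hU : expect q U = 0) {k l : κ} (hkl : k ≠ l) :
    expect (piPMF fun _ : κ => q) (fun a => U (a k) * U (a l)) = 0 := by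
  have h := expect_piPMF_prod (fun _ : κ => q)
    (fun j b => (if j = k then U b else 1) * (if j = l then U b else 1))
  rw [prod_eq_zero (s := univ) (mem_univ k) (by simpa [hkl] using hU)] at h
  simpa only [prod_mul_distrib, prod_ite_eq', mem_univ, if_true] using h

/-- The average of independent centred variables with a common law is centred. -/
theorem expect_piPMF_average {β : Type*} [Fintype β] (q : PMF β) (U : β → ℝ)
    (hU : expect q U = 0) (c : ℝ) :
    expect (piPMF fun _ : κ => q) (fun a => c * ∑ k, U (a k)) = 0 := by
  rw [expect_const_mul, expect_sum]
  simp [expect_piPMF_eval (fun _ : κ => q), hU]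

/-- The variance of a sum of independent centred variables with a common law. -/
theorem expect_piPMF_sum_sq {β : Type*} [Fintype β] (q : PMF β) (U : β → ℝ)
    (hU : expect q U = 0) :
    expect (piPMF fun _ : κ => q) (fun a => (∑ k, U (a k)) ^ 2)
      = Fintype.card κ * expect q (fun b => U b ^ 2) := by
  simp only [sq, sum_mul_sum]
  rw [expect_sum]
  have h : ∀ k : κ, expect (piPMF fun _ : κ => q) (fun a => ∑ l, U (a k) * U (a l))
      = expect q (fun b => U b * U b) := by
    intro k
    rw [expect_sum, sum_eq_single k]
    · exact expect_piPMF_eval (fun _ : κ => q) k (fun b => U b * U b)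
    · exact fun l _ hl => expect_piPMF_mul_of_ne q U hU hl.symm
    · simp
  simp [h]

end Product

/-! ### Exponential concentration -/

/-- Hoeffding's lemma, in the form for a symmetric range. -/
theorem expect_exp_le {α : Type*} [Fintype α] (q : PMF α) (U : α → ℝ) (hU : expect q U = 0)
    {b : ℝ} (hb : 0 < b) (hUb : ∀ a, |U a| ≤ b) (s : ℝ) :
    expect q (fun a => Real.exp (s * U a)) ≤ Real.exp ((s * b) ^ 2 / 2) := by
  -- On `[-b, b]` the convex function `exp (s * ·)` lies below its chord.
  have h : ∀ a, Real.exp (s * U a)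
      ≤ Real.cosh (s * b) + Real.sinh (s * b) / b * U a := by
    intro a
    obtain ⟨h1, h2⟩ := abs_le.1 (hUb a)
    have hc := convexOn_exp.2 (Set.mem_univ (s * b)) (Set.mem_univ (-(s * b)))
      (show 0 ≤ (b + U a) / (2 * b) from div_nonneg (by linarith) (by linarith))
      (show 0 ≤ (b - U a) / (2 * b) from div_nonneg (by linarith) (by linarith))
      (by field_simp; ring)
    simp only [smul_eq_mul] at hc
    have e1 : (b + U a) / (2 * b) * (s * b) + (b - U a) / (2 * b) * -(s * b) = s * U a := by
      field_simp; ring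
    rw [e1] at hc
    refine hc.trans_eq ?_
    rw [Real.cosh_eq, Real.sinh_eq]
    field_simp
    ring
  refine (expect_mono h).trans ?_
  rw [expect_add, expect_const, expect_const_mul, hU, mul_zero, add_zero]
  exact Real.cosh_le_exp_half_sq _

/-- Hoeffding's inequality (one-sided) for independent variables with a common law. -/
theorem prob_sum_ge_le {α : Type*} [Fintype α] (q : PMF α) (U : α → ℝ)
    (hU : expect q U = 0) {b : ℝ} (hb : 0 < b) (hUb : ∀ a, |U a| ≤ b) (m : ℕ) {σ : ℝ} (hσ : 0 < σ) :
    prob (piPMF fun _ : Fin m => q) {z | m * σ ≤ ∑ l, U (z l)}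
      ≤ Real.exp (-(m * σ ^ 2 / (2 * b ^ 2))) := by
  set s := σ / b ^ 2 with hs
  have hs0 : 0 < s := by positivity
  have h1 : ∀ z : Fin m → α, ({z | m * σ ≤ ∑ l, U (z l)}.indicator 1 : _ → ℝ) z
      ≤ Real.exp (-(s * (m * σ))) * ∏ l, Real.exp (s * U (z l)) := by
    intro z
    rw [← Real.exp_sum, ← Real.exp_add, ← mul_sum]
    by_cases hz : z ∈ {z : Fin m → α | m * σ ≤ ∑ l, U (z l)}
    · rw [Set.indicator_of_mem hz]
      have hz' : m * σ ≤ ∑ l, U (z l) := hz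
      refine Real.one_le_exp ?_
      nlinarith
    · rw [Set.indicator_of_notMem hz]
      positivity
  refine (expect_mono h1).trans ?_
  rw [expect_const_mul, expect_piPMF_prod (fun _ : Fin m => q)
    (fun _ a => Real.exp (s * U a)), prod_const, card_univ, Fintype.card_fin]
  have h2 := expect_exp_le q U hU hb hUb s
  have h0 : 0 ≤ expect q (fun a => Real.exp (s * U a)) := by
    rw [← expect_const q 0]
    exact expect_mono fun a => (Real.exp_pos _).le
  calc Real.exp (-(s * (m * σ))) * expect q (fun a => Real.exp (s * U a)) ^ m
      ≤ Real.exp (-(s * (m * σ))) * Real.exp ((s * b) ^ 2 / 2) ^ m := by gcongr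
    _ = Real.exp (-(m * σ ^ 2 / (2 * b ^ 2))) := by
        rw [← Real.exp_nat_mul, ← Real.exp_add]
        congr 1
        rw [hs]
        field_simp
        ring

/-! ### The multilinear extension -/

section Multilinear

variable {E : Type*} [Fintype E] [DecidableEq E]

/-- The marginal value of `e` with respect to the other elements of a set. -/
def marginal (f : Finset E → ℝ) (e : E) (S : Finset E) : ℝ := f (insert e S) - f (S.erase e)

/-- The probability that sampling every element other than `e` gives `S`, for `S` without `e`. -/
def weightAway (e : E) (x : E → ℝ) (S : Finset E) : ℝ :=
  (∏ i ∈ S, x i) * ∏ i ∈ univ.erase e \ S, (1 - x i)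

theorem multilinearExt_eq_sum_weightAway (f : Finset E → ℝ) (x : E → ℝ) (e : E) :
    multilinearExt f x = ∑ S ∈ (univ.erase e).powerset,
      weightAway e x S * ((1 - x e) * f S + x e * f (insert e S)) := by
  have hu : (univ : Finset (Finset E)) = (insert e (univ.erase e)).powerset := by
    rw [insert_erase (mem_univ e), powerset_univ]
  rw [multilinearExt, hu, sum_powerset_insert (notMem_erase e univ), ← sum_add_distrib]
  refine sum_congr rfl fun S hS => ?_
  have heS : e ∉ S := fun h => notMem_erase e univ (mem_powerset.1 hS h)
  have h1 : Sᶜ = insert e (univ.erase e \ S) := by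
    ext i; by_cases hi : i = e <;> simp [hi, heS]
  have h2 : (insert e S)ᶜ = univ.erase e \ S := by
    ext i; simp
  rw [h2, h1, prod_insert heS, prod_insert (by simp), weightAway]
  ring

theorem weightAway_update (e : E) (x : E → ℝ) (s : ℝ) {S : Finset E}
    (hS : S ∈ (univ.erase e).powerset) :
    weightAway e (Function.update x e s) S = weightAway e x S := by
  have h : ∀ i ∈ univ.erase e, Function.update x e s i = x i := fun i hi =>
    Function.update_of_ne (ne_of_mem_erase hi) _ _
  unfold weightAway
  congr 1
  · exact prod_congr rfl fun i hi => h i (mem_powerset.1 hS hi)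
  · exact prod_congr rfl fun i hi => by rw [h i (mem_sdiff.1 hi).1]

theorem multilinearExt_update (f : Finset E → ℝ) (x : E → ℝ) (e : E) (s : ℝ) :
    multilinearExt f (Function.update x e s)
      = multilinearExt (fun S => f (S.erase e)) x + s * multilinearExt (marginal f e) x := by
  rw [multilinearExt_eq_sum_weightAway f _ e, multilinearExt_eq_sum_weightAway _ x e,
    multilinearExt_eq_sum_weightAway (marginal f e) x e, mul_sum, ← sum_add_distrib]
  refine sum_congr rfl fun S hS => ?_
  have heS : e ∉ S := fun h => notMem_erase e univ (mem_powerset.1 hS h)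
  rw [weightAway_update e x s hS]
  simp only [marginal, Function.update_self, erase_insert heS, erase_eq_of_notMem heS,
    insert_idem]
  ring

/-- A partial derivative of the extension is the extension of the marginal values. -/
theorem multilinearGrad_apply (f : Finset E → ℝ) (x : E → ℝ) (e : E) :
    multilinearGrad f x e = multilinearExt (marginal f e) x := by
  have h : (fun s : ℝ => multilinearExt f (Function.update x e s)) = fun s =>
      multilinearExt (fun S => f (S.erase e)) x + s * multilinearExt (marginal f e) x :=
    funext fun s => multilinearExt_update f x e s
  rw [multilinearGrad, h]
  simp

theorem differentiable_multilinearExt (f : Finset E → ℝ) :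
    Differentiable ℝ (multilinearExt f) := by
  unfold multilinearExt
  fun_prop

theorem hasDerivAt_multilinearExt_line (f : Finset E → ℝ) (x d : E → ℝ) (s : ℝ) :
    HasDerivAt (fun s : ℝ => multilinearExt f (x + s • d))
      (d ⬝ᵥ multilinearGrad f (x + s • d)) s := by
  set y := x + s • d with hy
  have hF := (differentiable_multilinearExt f y).hasFDerivAt
  have hl : HasDerivAt (fun s : ℝ => x + s • d) d s := by
    simpa using ((hasDerivAt_id s).smul_const d).const_add x
  have h := hF.comp_hasDerivAt s hl
  have hd : d = ∑ e, d e • (Pi.single e (1 : ℝ) : E → ℝ) := by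
    funext i
    simp [Pi.single_apply]
  suffices hk : fderiv ℝ (multilinearExt f) y d = d ⬝ᵥ multilinearGrad f y by
    rw [hk] at h
    exact h
  refine (congrArg _ hd).trans ?_
  rw [map_sum]
  refine sum_congr rfl fun e _ => ?_
  rw [map_smul, smul_eq_mul, multilinearGrad]
  congr 1
  have hu : HasDerivAt (fun s : ℝ => Function.update y e s) (Pi.single e 1) (y e) :=
    hasDerivAt_update y e (y e)
  have hF' : HasFDerivAt (multilinearExt f) (fderiv ℝ (multilinearExt f) y)
      (Function.update y e (y e)) := by
    rwa [Function.update_eq_self]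
  exact (hF'.comp_hasDerivAt (y e) hu).deriv.symm

theorem sum_weight_eq_one (x : E → ℝ) :
    ∑ S : Finset E, (∏ e ∈ S, x e) * ∏ e ∈ Sᶜ, (1 - x e) = 1 := by
  have h := prod_add x (fun e => 1 - x e) (univ : Finset E)
  rw [powerset_univ] at h
  simp only [← compl_eq_univ_sdiff] at h
  rw [← h]
  simp

theorem weight_nonneg {x : E → ℝ} (hx : x ∈ Set.Icc (0 : E → ℝ) 1) (S : Finset E) :
    0 ≤ (∏ e ∈ S, x e) * ∏ e ∈ Sᶜ, (1 - x e) :=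
  mul_nonneg (prod_nonneg fun e _ => hx.1 e)
    (prod_nonneg fun e _ => sub_nonneg.2 (hx.2 e))

theorem multilinearExt_mono {f g : Finset E → ℝ} {x : E → ℝ} (hx : x ∈ Set.Icc (0 : E → ℝ) 1)
    (h : ∀ S, f S ≤ g S) : multilinearExt f x ≤ multilinearExt g x :=
  sum_le_sum fun S _ => mul_le_mul_of_nonneg_right (h S) (weight_nonneg hx S)

theorem multilinearExt_const (c : ℝ) (x : E → ℝ) : multilinearExt (fun _ => c) x = c := by
  rw [multilinearExt, ← mul_sum, sum_weight_eq_one, mul_one]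

theorem multilinearExt_sum {ι : Type*} (s : Finset ι) (w : ι → ℝ) (f : ι → Finset E → ℝ)
    (x : E → ℝ) : multilinearExt (fun A => ∑ i ∈ s, w i * f i A) x
      = ∑ i ∈ s, w i * multilinearExt (f i) x := by
  simp only [multilinearExt, sum_mul, mul_sum]
  rw [sum_comm]
  exact sum_congr rfl fun _ _ => sum_congr rfl fun _ _ => by ring

theorem multilinearExt_neg (f : Finset E → ℝ) (x : E → ℝ) :
    multilinearExt (fun S => -f S) x = -multilinearExt f x := by
  simp only [multilinearExt, neg_mul, sum_neg_distrib]

theorem multilinearExt_zero (f : Finset E → ℝ) : multilinearExt f 0 = f ∅ := by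
  rw [multilinearExt, sum_eq_single ∅]
  · simp
  · intro S _ hS
    obtain ⟨e, he⟩ := nonempty_iff_ne_empty.2 hS
    rw [prod_eq_zero he rfl]
    simp
  · simp

theorem multilinearGrad_sum {ι : Type*} (s : Finset ι) (w : ι → ℝ) (f : ι → Finset E → ℝ)
    (x : E → ℝ) (e : E) : multilinearGrad (fun A => ∑ i ∈ s, w i * f i A) x e
      = ∑ i ∈ s, w i * multilinearGrad (f i) x e := by
  simp only [multilinearGrad_apply]
  rw [← multilinearExt_sum]
  congr 1
  funext S
  simp only [marginal, mul_sub, sum_sub_distrib]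

theorem line_mem_Icc {x d : E → ℝ} (hx : x ∈ Set.Icc (0 : E → ℝ) 1)
    (hxd : x + d ∈ Set.Icc (0 : E → ℝ) 1) {s : ℝ} (hs : s ∈ Set.Icc (0 : ℝ) 1) :
    x + s • d ∈ Set.Icc (0 : E → ℝ) 1 := by
  have h := (convex_Icc (0 : E → ℝ) 1).add_smul_sub_mem hx hxd hs
  rwa [add_sub_cancel_left] at h

/-- A lower bound on all marginal values bounds the growth of the extension from below along
nonnegative directions. -/
theorem mul_sum_le_multilinearExt_sub (f : Finset E → ℝ) {c : ℝ} (hf : ∀ e S, c ≤ marginal f e S)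
    {x d : E → ℝ} (hd : 0 ≤ d) (hx : x ∈ Set.Icc (0 : E → ℝ) 1)
    (hxd : x + d ∈ Set.Icc (0 : E → ℝ) 1) :
    c * ∑ e, d e ≤ multilinearExt f (x + d) - multilinearExt f x := by
  have h := (convex_Icc (0 : ℝ) 1).mul_sub_le_image_sub_of_le_deriv
    (f := fun s : ℝ => multilinearExt f (x + s • d)) (C := c * ∑ e, d e)
    (fun s _ => (hasDerivAt_multilinearExt_line f x d s).continuousAt.continuousWithinAt)
    (fun s _ => (hasDerivAt_multilinearExt_line f x d s).differentiableAt.differentiableWithinAt)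
    (fun s hs => by
      rw [(hasDerivAt_multilinearExt_line f x d s).deriv, mul_sum]
      refine sum_le_sum fun e _ => ?_
      rw [mul_comm]
      refine mul_le_mul_of_nonneg_left ?_ (hd e)
      rw [multilinearGrad_apply, ← multilinearExt_const c (x + s • d)]
      exact multilinearExt_mono (line_mem_Icc hx hxd (interior_subset hs)) (hf e))
    0 (by simp) 1 (by simp) zero_le_one
  simpa using h

end Multilinear

section Submodular

variable {E : Type*} [Fintype E] [DecidableEq E] {f : Finset E → ℝ}

theorem marginal_nonneg (hm : Monotone f) (e : E) (S : Finset E) : 0 ≤ marginal f e S :=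
  sub_nonneg.2 (hm ((erase_subset e S).trans (subset_insert e S)))

theorem marginal_le_singleton (h0 : f ∅ = 0) (hs : IsSubmodular f) (e : E) (S : Finset E) :
    marginal f e S ≤ f {e} := by
  have h := hs ∅ (S.erase e) e (empty_subset _) (notMem_erase e S)
  have h1 : insert e (S.erase e) = insert e S := by ext i; by_cases hi : i = e <;> simp [hi]
  rw [h1, h0] at h
  simpa [marginal] using h

theorem marginal_antitone (hs : IsSubmodular f) (e : E) : Antitone (marginal f e) := by
  intro S T hST
  have h := hs (S.erase e) (T.erase e) e (erase_subset_erase e hST) (notMem_erase e T)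
  have h1 : ∀ S : Finset E, insert e (S.erase e) = insert e S := by
    intro S; ext i; by_cases hi : i = e <;> simp [hi]
  rw [h1, h1] at h
  exact h

theorem multilinearGrad_nonneg (hm : Monotone f) {x : E → ℝ} (hx : x ∈ Set.Icc (0 : E → ℝ) 1) :
    0 ≤ multilinearGrad f x := by
  intro e
  rw [multilinearGrad_apply, Pi.zero_apply, ← multilinearExt_const 0 x]
  exact multilinearExt_mono hx fun S => marginal_nonneg hm e S

theorem singleton_le_maxSingleton (f : Finset E → ℝ) (e : E) : f {e} ≤ maxSingleton f :=
  le_ciSup (f := fun e : E => f {e}) (Set.finite_range _).bddAbove e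

theorem maxSingleton_nonneg (h0 : f ∅ = 0) (hm : Monotone f) : 0 ≤ maxSingleton f :=
  Real.iSup_nonneg fun e => h0 ▸ hm (empty_subset {e})

/-- The gradient of the extension of a submodular function decreases along nonnegative
directions. -/
theorem multilinearGrad_add_le (hs : IsSubmodular f) {x d : E → ℝ} (hd : 0 ≤ d)
    (hx : x ∈ Set.Icc (0 : E → ℝ) 1) (hxd : x + d ∈ Set.Icc (0 : E → ℝ) 1) (e : E) :
    multilinearGrad f (x + d) e ≤ multilinearGrad f x e := by
  have h := mul_sum_le_multilinearExt_sub (fun S => -marginal f e S) (c := 0)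
    (fun e' S => sub_nonneg.2 (neg_le_neg
      (marginal_antitone hs e ((erase_subset e' S).trans (subset_insert e' S))))) hd hx hxd
  rw [multilinearExt_neg, multilinearExt_neg] at h
  rw [multilinearGrad_apply, multilinearGrad_apply]
  linarith

/-- The gradient of the extension of a monotone submodular function decreases at rate at most
`maxSingleton f` along nonnegative directions. -/
theorem multilinearGrad_sub_le (h0 : f ∅ = 0) (hm : Monotone f) (hs : IsSubmodular f)
    {x d : E → ℝ} (hd : 0 ≤ d) (hx : x ∈ Set.Icc (0 : E → ℝ) 1)
    (hxd : x + d ∈ Set.Icc (0 : E → ℝ) 1) (e : E) :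
    multilinearGrad f x e - maxSingleton f * ∑ i, d i ≤ multilinearGrad f (x + d) e := by
  have h := mul_sum_le_multilinearExt_sub (marginal f e) (c := -maxSingleton f)
    (fun e' S => by
      have h1 := marginal_nonneg hm e (insert e' S)
      have h2 := (marginal_le_singleton h0 hs e (S.erase e')).trans
        (singleton_le_maxSingleton f e)
      change _ ≤ marginal f e _ - marginal f e _
      linarith) hd hx hxd
  rw [multilinearGrad_apply, multilinearGrad_apply]
  linarith

/-- Concavity along nonnegative directions. -/
theorem multilinearExt_add_le (hs : IsSubmodular f) {x d : E → ℝ} (hd : 0 ≤ d)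
    (hx : x ∈ Set.Icc (0 : E → ℝ) 1) (hxd : x + d ∈ Set.Icc (0 : E → ℝ) 1) :
    multilinearExt f (x + d) ≤ multilinearExt f x + d ⬝ᵥ multilinearGrad f x := by
  have h := (convex_Icc (0 : ℝ) 1).image_sub_le_mul_sub_of_deriv_le
    (f := fun s : ℝ => multilinearExt f (x + s • d)) (C := d ⬝ᵥ multilinearGrad f x)
    (fun s _ => (hasDerivAt_multilinearExt_line f x d s).continuousAt.continuousWithinAt)
    (fun s _ => (hasDerivAt_multilinearExt_line f x d s).differentiableAt.differentiableWithinAt)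
    (fun s hs' => by
      rw [(hasDerivAt_multilinearExt_line f x d s).deriv]
      have hs1 := interior_subset hs'
      exact sum_le_sum fun e _ => mul_le_mul_of_nonneg_left
        (multilinearGrad_add_le hs (smul_nonneg hs1.1 hd) hx (line_mem_Icc hx hxd hs1) e) (hd e))
    0 (by simp) 1 (by simp) zero_le_one
  simp only [zero_smul, add_zero, one_smul, sub_zero, mul_one] at h
  linarith

/-- The second-order lower bound along nonnegative directions. -/
theorem multilinearExt_add_ge (h0 : f ∅ = 0) (hm : Monotone f) (hs : IsSubmodular f)
    {x d : E → ℝ} (hd : 0 ≤ d) (hx : x ∈ Set.Icc (0 : E → ℝ) 1)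
    (hxd : x + d ∈ Set.Icc (0 : E → ℝ) 1) :
    multilinearExt f x + d ⬝ᵥ multilinearGrad f x - maxSingleton f * (∑ i, d i) ^ 2 / 2
      ≤ multilinearExt f (x + d) := by
  set D := ∑ i, d i with hD
  have hder : ∀ s : ℝ, HasDerivAt (fun s : ℝ => multilinearExt f (x + s • d)
      + s ^ 2 * (maxSingleton f * D ^ 2 / 2))
      (d ⬝ᵥ multilinearGrad f (x + s • d) + s * (maxSingleton f * D ^ 2)) s := by
    intro s
    have h1 := (hasDerivAt_pow 2 s).mul_const (maxSingleton f * D ^ 2 / 2)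
    have h2 : s * (maxSingleton f * D ^ 2)
        = ((2 : ℕ) : ℝ) * s ^ (2 - 1) * (maxSingleton f * D ^ 2 / 2) := by
      norm_num
      ring
    rw [h2]
    exact (hasDerivAt_multilinearExt_line f x d s).add h1
  have h := (convex_Icc (0 : ℝ) 1).mul_sub_le_image_sub_of_le_deriv
    (f := fun s : ℝ => multilinearExt f (x + s • d) + s ^ 2 * (maxSingleton f * D ^ 2 / 2))
    (C := d ⬝ᵥ multilinearGrad f x)
    (fun s _ => (hder s).continuousAt.continuousWithinAt)
    (fun s _ => (hder s).differentiableAt.differentiableWithinAt)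
    (fun s hs' => by
      rw [(hder s).deriv]
      have hs1 := interior_subset hs'
      have h2 : ∑ e, d e * (multilinearGrad f x e - maxSingleton f * (s * D))
          ≤ d ⬝ᵥ multilinearGrad f (x + s • d) := by
        refine sum_le_sum fun e _ => mul_le_mul_of_nonneg_left ?_ (hd e)
        have := multilinearGrad_sub_le h0 hm hs (smul_nonneg hs1.1 hd) hx
          (line_mem_Icc hx hxd hs1) e
        simpa [← mul_sum, ← hD] using this
      have h3 : ∑ e, d e * (multilinearGrad f x e - maxSingleton f * (s * D))
          = d ⬝ᵥ multilinearGrad f x - s * (maxSingleton f * D ^ 2) := by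
        simp only [mul_sub, sum_sub_distrib, ← sum_mul, ← hD, dotProduct]
        ring
      linarith)
    0 (by simp) 1 (by simp) zero_le_one
  simp only [zero_smul, add_zero, one_smul, sub_zero, mul_one] at h
  norm_num at h
  linarith

/-- The first-order optimality gap: for `x` and `w` in the unit cube, the increase from `x` to `w`
is at most the linear gain of `w` at `x`. It is obtained by passing from `w` to the
coordinatewise maximum of `w` and `x`. -/
theorem multilinearExt_le_add_dotProduct (hm : Monotone f) (hs : IsSubmodular f) {x w : E → ℝ}
    (hx : x ∈ Set.Icc (0 : E → ℝ) 1) (hw : w ∈ Set.Icc (0 : E → ℝ) 1) :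
    multilinearExt f w ≤ multilinearExt f x + w ⬝ᵥ multilinearGrad f x := by
  have hsup : w ⊔ x ∈ Set.Icc (0 : E → ℝ) 1 := ⟨hw.1.trans le_sup_left, sup_le hw.2 hx.2⟩
  have h1 := mul_sum_le_multilinearExt_sub f (c := 0) (fun e S => marginal_nonneg hm e S)
    (x := w) (d := w ⊔ x - w) (sub_nonneg.2 le_sup_left) hw (by simpa using hsup)
  have h2 := multilinearExt_add_le hs (x := x) (d := w ⊔ x - x) (sub_nonneg.2 le_sup_right) hx
    (by simpa using hsup)
  have h3 : (w ⊔ x - x) ⬝ᵥ multilinearGrad f x ≤ w ⬝ᵥ multilinearGrad f x := by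
    refine sum_le_sum fun e _ => mul_le_mul_of_nonneg_right ?_ (multilinearGrad_nonneg hm hx e)
    have := hx.1 e
    have := hw.1 e
    simp only [Pi.sub_apply, Pi.sup_apply, Pi.zero_apply] at *
    rcases le_total (w e) (x e) with h | h
    · rw [sup_eq_right.2 h]; linarith
    · rw [sup_eq_left.2 h]; linarith
  rw [add_sub_cancel] at h1 h2
  linarith

theorem clip_mem_Icc (x : E → ℝ) : clip x ∈ Set.Icc (0 : E → ℝ) 1 :=
  ⟨fun _ => le_max_left _ _, fun _ => max_le zero_le_one (min_le_left _ _)⟩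

/-- At a point outside the unit cube the extension is read at the clipped point. -/
theorem expect_setPMF (f : Finset E → ℝ) (x : E → ℝ) :
    expect (setPMF x) f = multilinearExt f (clip x) := by
  refine sum_congr rfl fun S _ => ?_
  have h := clip_mem_Icc x
  have h1 : (setPMF x S).toReal = (∏ e ∈ S, clip x e) * ∏ e ∈ Sᶜ, (1 - clip x e) := by
    rw [setPMF, PMF.ofFintype_apply, ENNReal.toReal_mul, ENNReal.toReal_prod,
      ENNReal.toReal_prod]
    congr 1
    · exact prod_congr rfl fun e _ => ENNReal.toReal_ofReal (h.1 e)
    · exact prod_congr rfl fun e _ => ENNReal.toReal_ofReal (sub_nonneg.2 (h.2 e))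
  rw [h1, mul_comm]

end Submodular

/-! ### The matroid polytope -/

section Polytope

variable {E : Type*} [Fintype E] [DecidableEq E] {M : Matroid E} {r : ℕ}

theorem convex_matroidPolytope (M : Matroid E) : Convex ℝ (matroidPolytope M) :=
  convex_convexHull ℝ _

theorem zero_mem_matroidPolytope (M : Matroid E) : (0 : E → ℝ) ∈ matroidPolytope M :=
  subset_convexHull ℝ _ ⟨∅, M.empty_indep, (Set.indicator_empty' _).symm⟩

theorem matroidPolytope_subset_Icc (M : Matroid E) :
    matroidPolytope M ⊆ Set.Icc (0 : E → ℝ) 1 := by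
  refine convexHull_min ?_ (convex_Icc _ _)
  rintro _ ⟨I, -, rfl⟩
  exact ⟨fun e => Set.indicator_nonneg (fun _ _ => zero_le_one) e,
    fun e => Set.indicator_le_self' (fun _ _ => zero_le_one) e⟩

theorem sum_le_of_mem_matroidPolytope (hr : M.eRank = r) {v : E → ℝ}
    (hv : v ∈ matroidPolytope M) : ∑ e, v e ≤ r := by
  have h : matroidPolytope M ⊆ {v | ∑ e, v e ≤ r} := by
    refine convexHull_min ?_ ?_
    · rintro _ ⟨I, hI, rfl⟩
      classical
      have h1 := hI.encard_le_eRank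
      rw [hr, ← Set.coe_toFinset I, Set.encard_coe_eq_coe_finsetCard] at h1
      have h2 : I.toFinset.card ≤ r := by exact_mod_cast h1
      have h3 : ∑ e, I.indicator (1 : E → ℝ) e = I.toFinset.card := by
        simp [Set.indicator_apply]
      rw [Set.mem_ofPred_eq, h3]
      exact_mod_cast h2
    · intro u hu v hv a b ha hb hab
      simp only [Set.mem_ofPred_eq, Pi.add_apply, Pi.smul_apply, smul_eq_mul, sum_add_distrib,
        ← mul_sum] at *
      calc a * ∑ e, u e + b * ∑ e, v e ≤ a * r + b * r := by gcongr
        _ = r := by rw [← add_mul, hab, one_mul]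
  exact h hv

theorem smul_sum_mem_of_convex {κ : Type*} {P : Set (E → ℝ)} (hP : Convex ℝ P) (h0 : 0 ∈ P)
    (s : Finset κ) {c : ℝ} (hc : 0 ≤ c) (hcs : c * #s ≤ 1) {v : κ → E → ℝ}
    (hv : ∀ k ∈ s, v k ∈ P) : c • ∑ k ∈ s, v k ∈ P := by
  rcases s.eq_empty_or_nonempty with rfl | hs
  · simpa using h0
  have hs0 : (0 : ℝ) < #s := by exact_mod_cast hs.card_pos
  have h1 : ∑ k ∈ s, (1 / (#s : ℝ)) • v k ∈ P :=
    hP.sum_mem (fun _ _ => by positivity) (by simp [hs0.ne']) hv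
  have h2 := hP.smul_mem_of_zero_mem h0 h1 (t := c * #s) ⟨by positivity, hcs⟩
  rw [← smul_sum, smul_smul] at h2
  convert h2 using 2
  field_simp

theorem norm_toLp_le_of_mem_matroidPolytope (hr : M.eRank = r) {v : E → ℝ}
    (hv : v ∈ matroidPolytope M) : ‖WithLp.toLp 2 v‖ ≤ Real.sqrt r := by
  rw [EuclideanSpace.norm_eq]
  refine Real.sqrt_le_sqrt (le_trans (sum_le_sum fun e _ => ?_)
    (sum_le_of_mem_matroidPolytope hr hv))
  have h := matroidPolytope_subset_Icc M hv
  have h0 : 0 ≤ v e := h.1 e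
  have h1 : v e ≤ 1 := h.2 e
  simp only [Real.norm_eq_abs, sq_abs]
  nlinarith

theorem abs_dotProduct_le_norm_mul_norm (u v : E → ℝ) :
    |u ⬝ᵥ v| ≤ ‖WithLp.toLp 2 u‖ * ‖WithLp.toLp 2 v‖ := by
  have h := abs_real_inner_le_norm (WithLp.toLp 2 v : EuclideanSpace ℝ E) (WithLp.toLp 2 u)
  rw [mul_comm, EuclideanSpace.inner_toLp_toLp] at h
  simpa using h

theorem abs_dotProduct_le_of_mem_matroidPolytope (hr : M.eRank = r) {v a : E → ℝ} {c : ℝ}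
    (hv : v ∈ matroidPolytope M) (hc : 0 ≤ c) (ha : ∀ e, |a e| ≤ c) : |v ⬝ᵥ a| ≤ r * c := by
  have h0 := (matroidPolytope_subset_Icc M hv).1
  calc |v ⬝ᵥ a| ≤ ∑ e, |v e * a e| := abs_sum_le_sum_abs _ _
    _ ≤ ∑ e, v e * c := sum_le_sum fun e _ => by
        rw [abs_mul, abs_of_nonneg (h0 e)]
        exact mul_le_mul_of_nonneg_left (ha e) (h0 e)
    _ = (∑ e, v e) * c := by rw [sum_mul]
    _ ≤ r * c := mul_le_mul_of_nonneg_right (sum_le_of_mem_matroidPolytope hr hv) hc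

end Polytope

/-! ### Accuracy of the gradient estimates -/

section Estimate

variable {E : Type*} [Fintype E] [DecidableEq E]

theorem gradEst_nonneg {f : Finset E → ℝ} (hm : Monotone f) {m : ℕ} (ζ : Fin m → Finset E) :
    0 ≤ gradEst f ζ := fun e =>
  div_nonneg (sum_nonneg fun l _ => marginal_nonneg hm e (ζ l)) (Nat.cast_nonneg m)

/-- The event that the empirical gradient at `y` is off by at least `σ` in some coordinate. -/
def inaccurate (f : Finset E → ℝ) (σ : ℝ) (m : ℕ) (y : E → ℝ) : Set (Fin m → Finset E) :=
  {z | ∃ e, σ ≤ |gradEst f z e - multilinearGrad f (clip y) e|}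

/-- Marginal values lie in `[0, b]`, so Hoeffding's inequality applies to each coordinate. -/
theorem prob_inaccurate_le {f : Finset E → ℝ} (h0 : f ∅ = 0) (hm : Monotone f)
    (hs : IsSubmodular f) {b : ℝ} (hb : 0 < b) (hfb : ∀ e, f {e} ≤ b) {σ : ℝ} (hσ : 0 < σ)
    (m : ℕ) (y : E → ℝ) :
    prob (piPMF fun _ : Fin m => setPMF y) (inaccurate f σ m y)
      ≤ 2 * Fintype.card E * Real.exp (-(m * σ ^ 2 / (2 * b ^ 2))) := by
  set q := setPMF y
  set μ := multilinearGrad f (clip y) with hμ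
  have hμe : ∀ e, expect q (marginal f e) = μ e := fun e => by
    rw [expect_setPMF, hμ, multilinearGrad_apply]
  have hmem : ∀ e S, 0 ≤ marginal f e S ∧ marginal f e S ≤ b := fun e S =>
    ⟨marginal_nonneg hm e S, (marginal_le_singleton h0 hs e S).trans (hfb e)⟩
  have hμ' : ∀ e, 0 ≤ μ e ∧ μ e ≤ b := fun e => by
    rw [← hμe]
    exact ⟨(expect_const q 0).symm.le.trans (expect_mono fun S => (hmem e S).1),
      (expect_mono fun S => (hmem e S).2).trans (expect_const q b).le⟩
  have hsub : inaccurate f σ m y ⊆ ⋃ e, ({z | m * σ ≤ ∑ l, (marginal f e (z l) - μ e)}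
      ∪ {z | m * σ ≤ ∑ l, (μ e - marginal f e (z l))}) := by
    rintro z ⟨e, he⟩
    refine Set.mem_iUnion.2 ⟨e, ?_⟩
    have h1 : m * (gradEst f z e - μ e) = ∑ l, (marginal f e (z l) - μ e) := by
      rcases Nat.eq_zero_or_pos m with rfl | hm0
      · simp
      · have hm1 : (m : ℝ) ≠ 0 := by positivity
        rw [sum_sub_distrib, mul_sub, gradEst, mul_div_cancel₀ _ hm1]
        simp [marginal]
    have h2 : ∑ l, (μ e - marginal f e (z l)) = -∑ l, (marginal f e (z l) - μ e) := by
      rw [← sum_neg_distrib]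
      exact sum_congr rfl fun _ _ => by ring
    have h3 : m * σ ≤ |∑ l, (marginal f e (z l) - μ e)| := by
      rw [← h1, abs_mul, Nat.abs_cast]
      exact mul_le_mul_of_nonneg_left he (Nat.cast_nonneg m)
    rcases le_abs.1 h3 with h | h
    · exact Or.inl h
    · exact Or.inr (h.trans_eq h2.symm)
  refine (prob_mono _ hsub).trans ((prob_iUnion_le _ _).trans ?_)
  have hone : ∀ e, prob (piPMF fun _ : Fin m => q)
      ({z | m * σ ≤ ∑ l, (marginal f e (z l) - μ e)}
      ∪ {z | m * σ ≤ ∑ l, (μ e - marginal f e (z l))})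
      ≤ 2 * Real.exp (-(m * σ ^ 2 / (2 * b ^ 2))) := by
    intro e
    refine (prob_union_le _ _ _).trans ?_
    have h1 := prob_sum_ge_le q (fun S => marginal f e S - μ e)
      (by rw [expect_sub, expect_const, hμe, sub_self]) hb
      (fun S => abs_le.2 ⟨by linarith [(hmem e S).1, (hμ' e).2],
        by linarith [(hmem e S).2, (hμ' e).1]⟩) m hσ
    have h2 := prob_sum_ge_le q (fun S => μ e - marginal f e S)
      (by rw [expect_sub, expect_const, hμe, sub_self]) hb
      (fun S => abs_le.2 ⟨by linarith [(hmem e S).2, (hμ' e).1],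
        by linarith [(hmem e S).1, (hμ' e).2]⟩) m hσ
    linarith
  refine (sum_le_sum fun e _ => hone e).trans_eq ?_
  rw [sum_const, card_univ, nsmul_eq_mul]
  ring

end Estimate

namespace Input

/-! ### Trajectories -/

variable {E ι : Type*} [Fintype E] [DecidableEq E] [Fintype ι] [DecidableEq ι]
  (S : Input E ι)

/-- The maximizer that client `i` picks in local step `j`, and `0` when the draws are used up. -/
noncomputable def direction (ρ : ℕ) (i : ι) {n : ℕ} (ζ : Fin n → Fin S.m → Finset E) (j : ℕ) :
    E → ℝ :=
  if h : j < n then S.lmo ρ i j (gradEst (S.f i) (ζ ⟨j, h⟩)) else 0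

theorem localModel_eq (ρ : ℕ) (i : ι) (x : E → ℝ) {n : ℕ} (ζ : Fin n → Fin S.m → Finset E)
    (j : ℕ) : S.localModel ρ i x ζ j
      = x + (1 / (S.τ : ℝ)) • ∑ l ∈ range j, S.direction ρ i ζ l := by
  induction j with
  | zero => simp [localModel]
  | succ j ih =>
    rw [localModel, sum_range_succ, smul_add, ← add_assoc, ← ih, direction]
    split_ifs <;> simp

theorem localModel_snoc (ρ : ℕ) (i : ι) (x : E → ℝ) {n : ℕ} (ζ : Fin n → Fin S.m → Finset E)
    (z : Fin S.m → Finset E) {j : ℕ} (hj : j ≤ n) :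
    S.localModel ρ i x (Fin.snoc (α := fun _ => Fin S.m → Finset E) ζ z) j
      = S.localModel ρ i x ζ j := by
  induction j with
  | zero => rfl
  | succ j ih =>
    have h1 : j < n := hj
    have h2 : j < n + 1 := h1.trans n.lt_succ_self
    have h3 : (⟨j, h2⟩ : Fin (n + 1)) = Fin.castSucc ⟨j, h1⟩ := rfl
    rw [localModel, localModel, dif_pos h1, dif_pos h2, ih h1.le, h3, Fin.snoc_castSucc]

theorem serverModel_eq {n : ℕ} (ω : Fin n → S.RoundDraw) (j : ℕ) :
    S.serverModel ω j = S.η • ∑ ρ ∈ range j,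
      if h : ρ < n then S.aggregate ρ (S.serverModel ω ρ) (ω ⟨ρ, h⟩) else 0 := by
  induction j with
  | zero => simp [serverModel]
  | succ j ih =>
    rw [serverModel, sum_range_succ, smul_add, ← ih]
    split_ifs <;> simp

theorem serverModel_snoc {n : ℕ} (ω : Fin n → S.RoundDraw) (d : S.RoundDraw) {j : ℕ}
    (hj : j ≤ n) : S.serverModel (Fin.snoc (α := fun _ => S.RoundDraw) ω d) j
      = S.serverModel ω j := by
  induction j with
  | zero => rfl
  | succ j ih =>
    have h1 : j < n := hj
    have h2 : j < n + 1 := h1.trans n.lt_succ_self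
    have h3 : (⟨j, h2⟩ : Fin (n + 1)) = Fin.castSucc ⟨j, h1⟩ := rfl
    rw [serverModel, serverModel, dif_pos h1, dif_pos h2, ih h1.le, h3, Fin.snoc_castSucc]

variable {S} {M : Matroid E}

theorem direction_mem (hmono : ∀ i, Monotone (S.f i)) (hlmo : S.IsLinearMaximizer M) (ρ : ℕ)
    (i : ι) {n : ℕ} (ζ : Fin n → Fin S.m → Finset E) (j : ℕ) :
    S.direction ρ i ζ j ∈ matroidPolytope M := by
  rw [direction]
  split_ifs
  · exact (hlmo ρ i j _ (gradEst_nonneg (hmono i) _)).1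
  · exact zero_mem_matroidPolytope M

theorem localModel_sub_mem (hmono : ∀ i, Monotone (S.f i)) (hlmo : S.IsLinearMaximizer M)
    (hτ : 0 < S.τ) (ρ : ℕ) (i : ι) (x : E → ℝ) {n : ℕ} (ζ : Fin n → Fin S.m → Finset E) {j : ℕ}
    (hj : j ≤ S.τ) : S.localModel ρ i x ζ j - x ∈ matroidPolytope M := by
  rw [localModel_eq, add_sub_cancel_left]
  refine smul_sum_mem_of_convex (convex_matroidPolytope M) (zero_mem_matroidPolytope M) _
    (by positivity) ?_ fun l _ => direction_mem hmono hlmo ρ i ζ l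
  rw [card_range, div_mul_eq_mul_div, one_mul, div_le_one (by exact_mod_cast hτ)]
  exact_mod_cast hj

theorem aggregate_mem (hmono : ∀ i, Monotone (S.f i)) (hlmo : S.IsLinearMaximizer M)
    (hτ : 0 < S.τ) (hK : 0 < S.K) (ρ : ℕ) (x : E → ℝ) (d : S.RoundDraw) :
    S.aggregate ρ x d ∈ matroidPolytope M := by
  refine smul_sum_mem_of_convex (convex_matroidPolytope M) (zero_mem_matroidPolytope M) _
    (by positivity) ?_ fun k _ => localModel_sub_mem hmono hlmo hτ ρ _ x _ le_rfl
  have : (S.K : ℝ) ≠ 0 := by positivity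
  simp [this]

theorem serverModel_mem (hmono : ∀ i, Monotone (S.f i)) (hlmo : S.IsLinearMaximizer M)
    (hτ : 0 < S.τ) (hK : 0 < S.K) (hη : 0 ≤ S.η) {n : ℕ} (ω : Fin n → S.RoundDraw) {j : ℕ}
    (hj : S.η * j ≤ 1) : S.serverModel ω j ∈ matroidPolytope M := by
  rw [serverModel_eq]
  refine smul_sum_mem_of_convex (convex_matroidPolytope M) (zero_mem_matroidPolytope M) _ hη
    (by rwa [card_range]) fun ρ _ => ?_
  split_ifs
  · exact aggregate_mem hmono hlmo hτ hK ρ _ _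
  · exact zero_mem_matroidPolytope M

/-! ### The probability of an inaccurate estimate of an active client -/

variable (S)

/-- The event that some estimate of client `i` in its first `n` local steps is inaccurate. -/
def localInaccurate (σ : ℝ) (ρ : ℕ) (i : ι) (x : E → ℝ) (n : ℕ) :
    Set (Fin n → Fin S.m → Finset E) :=
  {ζ | ∃ j : Fin n, ζ j ∈ inaccurate (S.f i) σ S.m (S.localModel ρ i x ζ j)}

/-- The event that some estimate of an active client is inaccurate in round `ρ`. -/
def roundInaccurate (σ : ℝ) (ρ : ℕ) (x : E → ℝ) : Set S.RoundDraw :=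
  {d | ∃ k, d.2 (d.1 k) ∈ S.localInaccurate σ ρ (d.1 k) x S.τ}

/-- The event that some estimate of an active client is inaccurate in the first `n` rounds. -/
def historyInaccurate (σ : ℝ) (n : ℕ) : Set (Fin n → S.RoundDraw) :=
  {ω | ∃ ρ : Fin n, ω ρ ∈ S.roundInaccurate σ ρ (S.serverModel ω ρ)}

variable {S}

theorem prob_localInaccurate_le {σ ε : ℝ} (hε : ∀ i y,
      prob (piPMF fun _ : Fin S.m => setPMF y) (inaccurate (S.f i) σ S.m y) ≤ ε)
    (ρ : ℕ) (i : ι) (x : E → ℝ) (n : ℕ) :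
    prob (S.localPMF ρ i x n) (S.localInaccurate σ ρ i x n) ≤ n * ε := by
  induction n with
  | zero =>
    rw [localPMF, prob, expect_pure, Set.indicator_of_notMem]
    · simp
    · rintro ⟨j, -⟩
      exact j.elim0
  | succ n ih =>
    rw [localPMF]
    refine (prob_bind_map_le _ _ _ (s' := S.localInaccurate σ ρ i x n)
      (t := fun ζ => inaccurate (S.f i) σ S.m (S.localModel ρ i x ζ n)) ?_
      (fun ζ => hε i _)).trans ?_
    · rintro ζ z ⟨j, hj⟩
      rw [localModel_snoc S ρ i x ζ z (Nat.lt_succ_iff.1 j.2)] at hj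
      induction j using Fin.lastCases with
      | last => exact Or.inr (by simpa using hj)
      | cast j => exact Or.inl ⟨j, by simpa using hj⟩
    · push_cast
      linarith

theorem prob_roundInaccurate_le {σ ε : ℝ} (hε : ∀ i y,
      prob (piPMF fun _ : Fin S.m => setPMF y) (inaccurate (S.f i) σ S.m y) ≤ ε)
    (ρ : ℕ) (x : E → ℝ) :
    prob (S.roundPMF ρ x) (S.roundInaccurate σ ρ x) ≤ S.K * (S.τ * ε) := by
  rw [roundPMF, prob, expect_bind, ← expect_const (piPMF fun _ : Fin S.K => S.p)
    (S.K * (S.τ * ε))]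
  refine expect_mono fun A => ?_
  rw [expect_map]
  have h := prob_iUnion_le (piPMF fun i => S.localPMF ρ i x S.τ)
    (fun k => {ζ | ζ (A k) ∈ S.localInaccurate σ ρ (A k) x S.τ})
  refine le_trans (expect_mono fun ζ => ?_) (h.trans ?_)
  · have : (A, ζ) ∈ S.roundInaccurate σ ρ x
        ↔ ζ ∈ ⋃ k, {ζ | ζ (A k) ∈ S.localInaccurate σ ρ (A k) x S.τ} := by
      simp [roundInaccurate]
    by_cases hz : (A, ζ) ∈ S.roundInaccurate σ ρ x
    · rw [Set.indicator_of_mem hz, Set.indicator_of_mem (this.1 hz)]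
      rfl
    · rw [Set.indicator_of_notMem hz, Set.indicator_of_notMem fun h => hz (this.2 h)]
  · refine (sum_le_sum (g := fun _ => S.τ * ε) fun k _ => ?_).trans_eq (by simp)
    have h1 := expect_piPMF_eval (fun i => S.localPMF ρ i x S.τ) (A k)
      ((S.localInaccurate σ ρ (A k) x S.τ).indicator 1)
    exact h1.trans_le (prob_localInaccurate_le hε ρ (A k) x S.τ)

theorem prob_historyInaccurate_le {σ ε : ℝ} (hε : ∀ i y,
      prob (piPMF fun _ : Fin S.m => setPMF y) (inaccurate (S.f i) σ S.m y) ≤ ε) (n : ℕ) :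
    prob (S.historyPMF n) (S.historyInaccurate σ n) ≤ n * (S.K * (S.τ * ε)) := by
  induction n with
  | zero =>
    rw [historyPMF, prob, expect_pure, Set.indicator_of_notMem]
    · simp
    · rintro ⟨j, -⟩
      exact j.elim0
  | succ n ih =>
    rw [historyPMF]
    refine (prob_bind_map_le _ _ _ (s' := S.historyInaccurate σ n)
      (t := fun ω => S.roundInaccurate σ n (S.serverModel ω n)) ?_
      (fun ω => prob_roundInaccurate_le hε n _)).trans ?_
    · rintro ω d ⟨j, hj⟩
      rw [serverModel_snoc S ω d (Nat.lt_succ_iff.1 j.2)] at hj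
      induction j using Fin.lastCases with
      | last => exact Or.inr (by simpa using hj)
      | cast j => exact Or.inl ⟨j, by simpa using hj⟩
    · push_cast
      linarith

end Input

/-! ### The objective -/

namespace Input

variable {E ι : Type*} [Fintype E] [DecidableEq E] [Fintype ι] [DecidableEq ι]
  {S : Input E ι} {M : Matroid E} {r : ℕ}

theorem F_empty (h0 : ∀ i, S.f i ∅ = 0) : S.F ∅ = 0 := by simp [F, h0]

theorem F_monotone (hmono : ∀ i, Monotone (S.f i)) : Monotone S.F := fun _ _ hAB =>
  sum_le_sum fun i _ => mul_le_mul_of_nonneg_left (hmono i hAB) ENNReal.toReal_nonneg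

theorem F_submodular (hsub : ∀ i, IsSubmodular (S.f i)) : IsSubmodular S.F := by
  intro A B e hAB he
  simp only [F, ← sum_sub_distrib, ← mul_sub]
  exact sum_le_sum fun i _ => mul_le_mul_of_nonneg_left (hsub i A B e hAB he)
    ENNReal.toReal_nonneg

theorem dotProduct_multilinearGrad_F (w x : E → ℝ) :
    w ⬝ᵥ multilinearGrad S.F x = expect S.p fun i => w ⬝ᵥ multilinearGrad (S.f i) x := by
  simp only [dotProduct, expect, mul_sum]
  rw [sum_comm]
  refine sum_congr rfl fun e _ => ?_
  rw [show S.F = fun A => ∑ i, (S.p i).toReal * S.f i A from rfl, multilinearGrad_sum, mul_sum]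
  exact sum_congr rfl fun i _ => by ring

theorem multilinearExt_F_nonneg (h0 : ∀ i, S.f i ∅ = 0) (hmono : ∀ i, Monotone (S.f i))
    {x : E → ℝ} (hx : x ∈ Set.Icc (0 : E → ℝ) 1) : 0 ≤ multilinearExt S.F x := by
  rw [← multilinearExt_const 0 x]
  exact multilinearExt_mono hx fun A => F_empty h0 ▸ F_monotone hmono (empty_subset A)

theorem opt_nonneg (h0 : ∀ i, S.f i ∅ = 0) (hmono : ∀ i, Monotone (S.f i)) (M : Matroid E) :
    0 ≤ S.opt M := by
  refine Real.sSup_nonneg ?_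
  rintro _ ⟨w, hw, rfl⟩
  exact multilinearExt_F_nonneg h0 hmono (matroidPolytope_subset_Icc M hw)

variable (S)

/-- A maximizer over the polytope of the linear function given by the gradient of the objective
at the server model; the oracle of any client provides one. -/
noncomputable def bestDirection (ρ : ℕ) (x : E → ℝ) : E → ℝ :=
  S.lmo ρ S.p.support_nonempty.some 0 (multilinearGrad S.F x)

variable {S}

theorem bestDirection_mem (hmono : ∀ i, Monotone (S.f i)) (hlmo : S.IsLinearMaximizer M) (ρ : ℕ)
    {x : E → ℝ} (hx : x ∈ Set.Icc (0 : E → ℝ) 1) : S.bestDirection ρ x ∈ matroidPolytope M :=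
  (hlmo ρ _ 0 _ (multilinearGrad_nonneg (F_monotone hmono) hx)).1

theorem dotProduct_le_bestDirection (hmono : ∀ i, Monotone (S.f i))
    (hlmo : S.IsLinearMaximizer M) (ρ : ℕ) {x w : E → ℝ} (hx : x ∈ Set.Icc (0 : E → ℝ) 1)
    (hw : w ∈ matroidPolytope M) :
    w ⬝ᵥ multilinearGrad S.F x ≤ S.bestDirection ρ x ⬝ᵥ multilinearGrad S.F x :=
  (hlmo ρ _ 0 _ (multilinearGrad_nonneg (F_monotone hmono) hx)).2 w hw

/-- The optimality gap of a point is at most the linear gain of the best direction. -/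
theorem opt_le_add_bestDirection (hmono : ∀ i, Monotone (S.f i))
    (hsub : ∀ i, IsSubmodular (S.f i)) (hlmo : S.IsLinearMaximizer M) (ρ : ℕ) {x : E → ℝ}
    (hx : x ∈ Set.Icc (0 : E → ℝ) 1) :
    S.opt M ≤ multilinearExt S.F x + S.bestDirection ρ x ⬝ᵥ multilinearGrad S.F x := by
  refine csSup_le (Set.Nonempty.image _ ⟨0, zero_mem_matroidPolytope M⟩) ?_
  rintro _ ⟨w, hw, rfl⟩
  refine (multilinearExt_le_add_dotProduct (F_monotone hmono) (F_submodular hsub) hx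
    (matroidPolytope_subset_Icc M hw)).trans ?_
  gcongr
  exact dotProduct_le_bestDirection hmono hlmo ρ hx hw

/-! ### The gain of a client in one round -/

variable (S)

/-- The gain of the local model change of client `i`, to first order. -/
noncomputable def gain (ρ : ℕ) (x : E → ℝ) (ζ : ι → Fin S.τ → Fin S.m → Finset E) (i : ι) : ℝ :=
  (S.localModel ρ i x (ζ i) S.τ - x) ⬝ᵥ multilinearGrad S.F x

/-- The gain of client `i`, raised to the value that it has at least when all estimates of this
client are accurate. Unlike `gain`, it obeys deterministic bounds for every client, so that the
inactive clients need not be accurate. -/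
noncomputable def truncGain (s : ℝ) (ρ : ℕ) (x : E → ℝ)
    (ζ : ι → Fin S.τ → Fin S.m → Finset E) (i : ι) : ℝ :=
  max (S.gain ρ x ζ i) (S.bestDirection ρ x ⬝ᵥ multilinearGrad (S.f i) x - s)

/-- The client gradients are within `c` of the gradient of the objective at `x`. -/
def HeterogeneityAt (c : ℝ) (x : E → ℝ) : Prop :=
  ∀ i, ‖multilinearGrad (S.f i) x - multilinearGrad S.F x‖ ≤ c

variable {S}

theorem HeterogeneityAt.nonneg {c : ℝ} {x : E → ℝ} (h : S.HeterogeneityAt c x) : 0 ≤ c :=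
  (norm_nonneg _).trans (h S.p.support_nonempty.some)

theorem HeterogeneityAt.abs_dotProduct_sub_le {c : ℝ} {x : E → ℝ} (h : S.HeterogeneityAt c x)
    (hr : M.eRank = r) {v : E → ℝ} (hv : v ∈ matroidPolytope M) (i : ι) :
    |v ⬝ᵥ multilinearGrad (S.f i) x - v ⬝ᵥ multilinearGrad S.F x| ≤ r * c := by
  rw [← dotProduct_sub]
  exact abs_dotProduct_le_of_mem_matroidPolytope hr hv h.nonneg fun e =>
    (norm_le_pi_norm (multilinearGrad (S.f i) x - multilinearGrad S.F x) e).trans (h i)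

theorem truncGain_bounds (hmono : ∀ i, Monotone (S.f i)) (hlmo : S.IsLinearMaximizer M)
    (hr : M.eRank = r) (hτ : 0 < S.τ) {c s : ℝ} (hs : r * c ≤ s) (ρ : ℕ) {x : E → ℝ}
    (hx : x ∈ Set.Icc (0 : E → ℝ) 1) (hc : S.HeterogeneityAt c x)
    (ζ : ι → Fin S.τ → Fin S.m → Finset E) (i : ι) :
    S.bestDirection ρ x ⬝ᵥ multilinearGrad S.F x - (r * c + s) ≤ S.truncGain s ρ x ζ i ∧
      S.truncGain s ρ x ζ i ≤ S.bestDirection ρ x ⬝ᵥ multilinearGrad S.F x := by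
  have h := abs_le.1 (hc.abs_dotProduct_sub_le hr (bestDirection_mem hmono hlmo ρ hx) i)
  refine ⟨le_trans ?_ (le_max_right _ _), max_le ?_ ?_⟩
  · linarith [h.1]
  · exact dotProduct_le_bestDirection hmono hlmo ρ hx
      (localModel_sub_mem hmono hlmo hτ ρ i x (ζ i) le_rfl)
  · linarith [h.2]

/-- On average over the clients the heterogeneity cancels in the lower bound. -/
theorem bestDirection_sub_le_expect_truncGain (s : ℝ) (ρ : ℕ) (x : E → ℝ)
    (ζ : ι → Fin S.τ → Fin S.m → Finset E) :
    S.bestDirection ρ x ⬝ᵥ multilinearGrad S.F x - s ≤ expect S.p (S.truncGain s ρ x ζ) := by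
  rw [dotProduct_multilinearGrad_F, ← expect_const S.p s, ← expect_sub]
  simp only [expect_const]
  exact expect_mono fun i => le_max_right _ _

/-- An accurate client gains at least as much as the best direction, up to the errors of the
estimates, the drift of the local models and the heterogeneity. -/
theorem bestDirection_sub_le_gain (hmono : ∀ i, Monotone (S.f i)) (hlmo : S.IsLinearMaximizer M)
    (hr : M.eRank = r) (hτ : 0 < S.τ) {c σ L : ℝ} (hσ : 0 ≤ σ) (hL : 0 ≤ L) (ρ : ℕ)
    {x : E → ℝ} (hx : x ∈ Set.Icc (0 : E → ℝ) 1) (hc : S.HeterogeneityAt c x)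
    (ζ : ι → Fin S.τ → Fin S.m → Finset E) (i : ι)
    (hacc : ζ i ∉ S.localInaccurate σ ρ i x S.τ)
    (hLip : ∀ j < S.τ, ‖WithLp.toLp 2 (multilinearGrad (S.f i)
        (clip (S.localModel ρ i x (ζ i) j)) - multilinearGrad (S.f i) x)‖
      ≤ L * ‖WithLp.toLp 2 (S.localModel ρ i x (ζ i) j - x)‖) :
    S.bestDirection ρ x ⬝ᵥ multilinearGrad (S.f i) x - r * (c + 2 * σ + 2 * L)
      ≤ S.gain ρ x ζ i := by
  set w := S.bestDirection ρ x
  have hw : w ∈ matroidPolytope M := bestDirection_mem hmono hlmo ρ hx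
  have hstep : ∀ j ∈ range S.τ, w ⬝ᵥ multilinearGrad (S.f i) x - r * (c + 2 * σ + 2 * L)
      ≤ S.direction ρ i (ζ i) j ⬝ᵥ multilinearGrad S.F x := by
    intro j hj
    have hj := mem_range.1 hj
    set v := S.direction ρ i (ζ i) j with hv_def
    have hv : v ∈ matroidPolytope M := direction_mem hmono hlmo ρ i (ζ i) j
    set y := S.localModel ρ i x (ζ i) j
    set g := gradEst (S.f i) (ζ i ⟨j, hj⟩)
    -- The drift: for `u` in the polytope, the gradients at `x` and `y` give close values.
    have hdrift : ∀ u ∈ matroidPolytope M,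
        |u ⬝ᵥ multilinearGrad (S.f i) (clip y) - u ⬝ᵥ multilinearGrad (S.f i) x| ≤ r * L := by
      intro u hu
      rw [← dotProduct_sub]
      refine (abs_dotProduct_le_norm_mul_norm _ _).trans ?_
      have h1 := norm_toLp_le_of_mem_matroidPolytope hr hu
      have h2 := norm_toLp_le_of_mem_matroidPolytope hr
        (localModel_sub_mem hmono hlmo hτ ρ i x (ζ i) hj.le)
      calc _ ≤ Real.sqrt r * (L * Real.sqrt r) :=
            mul_le_mul h1 ((hLip j hj).trans (mul_le_mul_of_nonneg_left h2 hL)) (norm_nonneg _)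
              (Real.sqrt_nonneg _)
        _ = r * L := by
            rw [mul_left_comm, Real.mul_self_sqrt (Nat.cast_nonneg r), mul_comm]
    have hest : ∀ u ∈ matroidPolytope M,
        |u ⬝ᵥ g - u ⬝ᵥ multilinearGrad (S.f i) (clip y)| ≤ r * σ := by
      intro u hu
      rw [← dotProduct_sub]
      refine abs_dotProduct_le_of_mem_matroidPolytope hr hu hσ fun e => ?_
      by_contra! he
      exact hacc ⟨⟨j, hj⟩, e, he.le⟩
    have hmax : w ⬝ᵥ g ≤ v ⬝ᵥ g := by
      have hv' : v = S.lmo ρ i j g := by rw [hv_def, direction, dif_pos hj]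
      rw [hv']
      exact (hlmo ρ i j g (gradEst_nonneg (hmono i) _)).2 w hw
    have h1 := abs_le.1 (hdrift v hv)
    have h2 := abs_le.1 (hdrift w hw)
    have h3 := abs_le.1 (hest v hv)
    have h4 := abs_le.1 (hest w hw)
    have h5 := abs_le.1 (hc.abs_dotProduct_sub_le hr hv i)
    linarith [h1.1, h1.2, h2.1, h2.2, h3.1, h3.2, h4.1, h4.2, h5.1, h5.2]
  have hsum := sum_le_sum hstep
  rw [sum_const, card_range, nsmul_eq_mul] at hsum
  have hτ' : (0 : ℝ) < S.τ := by exact_mod_cast hτ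
  rw [gain, localModel_eq, add_sub_cancel_left, smul_dotProduct, sum_dotProduct, smul_eq_mul,
    one_div, inv_mul_eq_div, le_div_iff₀ hτ', mul_comm]
  exact hsum

/-! ### The noise of the client sampling -/

variable (S)

open Classical in
/-- The loss of the sampled average of the truncated gains against their mean. It is set to `0`
where the heterogeneity bound fails, which makes its second moment bounded everywhere. -/
noncomputable def noise (γ s : ℕ → ℝ) (ρ : ℕ) (x : E → ℝ) (d : S.RoundDraw) : ℝ :=
  if S.HeterogeneityAt (γ ρ) x then
    1 / (S.K : ℝ) * ∑ k, (expect S.p (S.truncGain (s ρ) ρ x d.2)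
      - S.truncGain (s ρ) ρ x d.2 (d.1 k))
  else 0

/-- The discounted sum of the noise of the rounds. -/
noncomputable def noiseSum (γ s : ℕ → ℝ) {n : ℕ} (ω : Fin n → S.RoundDraw) : ℕ → ℝ
  | 0 => 0
  | ρ + 1 =>
    if h : ρ < n then
      (1 - S.η) * noiseSum γ s ω ρ + S.η * S.noise γ s ρ (S.serverModel ω ρ) (ω ⟨ρ, h⟩)
    else noiseSum γ s ω ρ

variable {S}

theorem noiseSum_snoc (γ s : ℕ → ℝ) {n : ℕ} (ω : Fin n → S.RoundDraw) (d : S.RoundDraw) {j : ℕ}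
    (hj : j ≤ n) : S.noiseSum γ s (Fin.snoc (α := fun _ => S.RoundDraw) ω d) j
      = S.noiseSum γ s ω j := by
  induction j with
  | zero => rfl
  | succ j ih =>
    have h1 : j < n := hj
    have h2 : j < n + 1 := h1.trans n.lt_succ_self
    have h3 : (⟨j, h2⟩ : Fin (n + 1)) = Fin.castSucc ⟨j, h1⟩ := rfl
    rw [noiseSum, noiseSum, dif_pos h1, dif_pos h2, ih h1.le, h3, Fin.snoc_castSucc,
      serverModel_snoc S ω d h1.le]

/-- The clients' samples are independent of the choice of the clients, so the choice may be
averaged first. -/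
theorem expect_roundPMF (ρ : ℕ) (x : E → ℝ) (g : S.RoundDraw → ℝ) :
    expect (S.roundPMF ρ x) g = expect (piPMF fun i => S.localPMF ρ i x S.τ)
      fun ζ => expect (piPMF fun _ : Fin S.K => S.p) fun A => g (A, ζ) := by
  rw [roundPMF, expect_bind, ← expect_comm]
  simp only [expect_map]

theorem expect_noise (γ s : ℕ → ℝ) (ρ : ℕ) (x : E → ℝ) :
    expect (S.roundPMF ρ x) (S.noise γ s ρ x) = 0 := by
  rw [expect_roundPMF]
  by_cases h : S.HeterogeneityAt (γ ρ) x
  · simp only [noise, if_pos h]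
    rw [← expect_const (piPMF fun i => S.localPMF ρ i x S.τ) 0]
    congr 1
    funext ζ
    exact expect_piPMF_average S.p (fun i => expect S.p (S.truncGain (s ρ) ρ x ζ)
      - S.truncGain (s ρ) ρ x ζ i) (by rw [expect_sub, expect_const, sub_self]) _
  · simp only [noise, if_neg h, expect_const]

theorem expect_noise_sq_le (hmono : ∀ i, Monotone (S.f i)) (hlmo : S.IsLinearMaximizer M)
    (hr : M.eRank = r) (hτ : 0 < S.τ) (hK : 0 < S.K) {γ s : ℕ → ℝ}
    (hs : ∀ ρ, r * γ ρ ≤ s ρ) (ρ : ℕ) {x : E → ℝ} (hx : x ∈ Set.Icc (0 : E → ℝ) 1) :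
    expect (S.roundPMF ρ x) (fun d => S.noise γ s ρ x d ^ 2)
      ≤ (r * γ ρ + s ρ) ^ 2 / (4 * S.K) := by
  have hK' : (0 : ℝ) < S.K := by exact_mod_cast hK
  rw [expect_roundPMF]
  by_cases h : S.HeterogeneityAt (γ ρ) x
  · simp only [noise, if_pos h]
    rw [← expect_const (piPMF fun i => S.localPMF ρ i x S.τ) ((r * γ ρ + s ρ) ^ 2 / (4 * S.K))]
    refine expect_mono fun ζ => ?_
    simp only [mul_pow]
    rw [expect_const_mul, expect_piPMF_sum_sq S.p (fun i => expect S.p (S.truncGain (s ρ) ρ x ζ)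
      - S.truncGain (s ρ) ρ x ζ i) (by rw [expect_sub, expect_const, sub_self]), Fintype.card_fin]
    have h1 := expect_sq_sub_mean_le S.p (S.truncGain (s ρ) ρ x ζ)
      (truncGain_bounds hmono hlmo hr hτ (hs ρ) ρ hx h ζ)
    calc (1 / (S.K : ℝ)) ^ 2 * (S.K * expect S.p fun i =>
          (expect S.p (S.truncGain (s ρ) ρ x ζ) - S.truncGain (s ρ) ρ x ζ i) ^ 2)
        ≤ (1 / (S.K : ℝ)) ^ 2 * (S.K * ((r * γ ρ + s ρ) ^ 2 / 4)) := by gcongr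
      _ = (r * γ ρ + s ρ) ^ 2 / (4 * S.K) := by field_simp
  · simp only [noise, if_neg h, expect_const]
    rw [zero_pow two_ne_zero]
    positivity

/-- The noise of different rounds is uncorrelated. -/
theorem expect_noiseSum_sq_le (hmono : ∀ i, Monotone (S.f i)) (hlmo : S.IsLinearMaximizer M)
    (hr : M.eRank = r) (hτ : 0 < S.τ) (hK : 0 < S.K) (hη : 0 ≤ S.η) (hη1 : S.η ≤ 1)
    {γ s : ℕ → ℝ} (hs : ∀ ρ, r * γ ρ ≤ s ρ) {n : ℕ} (hn : S.η * n ≤ 1) :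
    expect (S.historyPMF n) (fun ω => S.noiseSum γ s ω n ^ 2)
      ≤ ∑ ρ ∈ range n, S.η ^ 2 * ((r * γ ρ + s ρ) ^ 2 / (4 * S.K)) := by
  induction n with
  | zero => simp [historyPMF, expect_pure, noiseSum]
  | succ n ih =>
    have hn' : S.η * n ≤ 1 := by
      push_cast at hn
      linarith
    rw [historyPMF, expect_bind, sum_range_succ]
    refine le_trans ?_ (add_le_add_left (ih hn') _)
    rw [← expect_const (S.historyPMF n) (S.η ^ 2 * ((r * γ n + s n) ^ 2 / (4 * S.K))),
      ← expect_add]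
    refine expect_mono fun ω => ?_
    rw [expect_map]
    have hrec : ∀ d : S.RoundDraw,
        S.noiseSum γ s (Fin.snoc (α := fun _ => S.RoundDraw) ω d) (n + 1) ^ 2
          = ((1 - S.η) * S.noiseSum γ s ω n) ^ 2
            + (2 * ((1 - S.η) * S.noiseSum γ s ω n) * S.η)
                * S.noise γ s n (S.serverModel ω n) d
            + S.η ^ 2 * S.noise γ s n (S.serverModel ω n) d ^ 2 := by
      intro d
      have hl : (⟨n, n.lt_succ_self⟩ : Fin (n + 1)) = Fin.last n := rfl
      rw [noiseSum, dif_pos n.lt_succ_self, hl, Fin.snoc_last, noiseSum_snoc γ s ω d le_rfl,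
        serverModel_snoc S ω d le_rfl]
      ring
    simp only [hrec]
    rw [expect_add, expect_add, expect_const, expect_const_mul, expect_noise, mul_zero, add_zero,
      expect_const_mul]
    have hx := matroidPolytope_subset_Icc M (serverModel_mem hmono hlmo hτ hK hη ω hn')
    have h1 := expect_noise_sq_le hmono hlmo hr hτ hK hs n hx
    have h2 : ((1 - S.η) * S.noiseSum γ s ω n) ^ 2 ≤ S.noiseSum γ s ω n ^ 2 := by
      rw [mul_pow]
      exact mul_le_of_le_one_left (sq_nonneg _) (pow_le_one₀ (by linarith) (by linarith))
    have h3 := mul_le_mul_of_nonneg_left h1 (sq_nonneg S.η)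
    linarith

/-! ### The recursion for the optimality gap -/

/-- One round contracts the optimality gap by the factor `1 - η`, up to the errors. -/
theorem opt_sub_le_round (h0 : ∀ i, S.f i ∅ = 0) (hmono : ∀ i, Monotone (S.f i))
    (hsub : ∀ i, IsSubmodular (S.f i)) (hlmo : S.IsLinearMaximizer M) (hr : M.eRank = r)
    (hτ : 0 < S.τ) (hK : 0 < S.K) (hη : 0 ≤ S.η) {γ s : ℕ → ℝ} (ρ : ℕ) {x : E → ℝ}
    {d : S.RoundDraw} (hx : x ∈ Set.Icc (0 : E → ℝ) 1)
    (hx' : x + S.η • S.aggregate ρ x d ∈ Set.Icc (0 : E → ℝ) 1)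
    (hc : S.HeterogeneityAt (γ ρ) x)
    (hgain : ∀ k, S.bestDirection ρ x ⬝ᵥ multilinearGrad (S.f (d.1 k)) x - s ρ
      ≤ S.gain ρ x d.2 (d.1 k)) :
    S.opt M - multilinearExt S.F (x + S.η • S.aggregate ρ x d)
      ≤ (1 - S.η) * (S.opt M - multilinearExt S.F x)
        + (S.η * s ρ + S.η ^ 2 * r ^ 2 * maxSingleton S.F / 2) + S.η * S.noise γ s ρ x d := by
  have hK' : (S.K : ℝ) ≠ 0 := by positivity
  set Δ := S.aggregate ρ x d with hΔ
  have hΔP : Δ ∈ matroidPolytope M := aggregate_mem hmono hlmo hτ hK ρ x d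
  have hΔ0 := (matroidPolytope_subset_Icc M hΔP).1
  have h1 := multilinearExt_add_ge (F_empty h0) (F_monotone hmono) (F_submodular hsub)
    (smul_nonneg hη hΔ0) hx hx'
  have hsum : ∑ e, (S.η • Δ) e = S.η * ∑ e, Δ e := by simp [mul_sum]
  have hm0 := maxSingleton_nonneg (F_empty h0) (F_monotone hmono)
  have h2 : maxSingleton S.F * (∑ e, (S.η • Δ) e) ^ 2 / 2
      ≤ S.η ^ 2 * r ^ 2 * maxSingleton S.F / 2 := by
    have h3 : (∑ e, Δ e) ^ 2 ≤ (r : ℝ) ^ 2 :=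
      pow_le_pow_left₀ (sum_nonneg fun e _ => hΔ0 e) (sum_le_of_mem_matroidPolytope hr hΔP) 2
    have h4 := mul_le_mul_of_nonneg_left h3 (mul_nonneg hm0 (sq_nonneg S.η))
    rw [hsum, mul_pow]
    linarith
  have h5 : Δ ⬝ᵥ multilinearGrad S.F x
      = expect S.p (S.truncGain (s ρ) ρ x d.2) - S.noise γ s ρ x d := by
    have h6 : ∀ k, S.truncGain (s ρ) ρ x d.2 (d.1 k) = S.gain ρ x d.2 (d.1 k) := fun k =>
      max_eq_left (hgain k)
    rw [noise, if_pos hc, sum_sub_distrib, sum_const, card_univ, Fintype.card_fin, nsmul_eq_mul,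
      mul_sub, ← mul_assoc, one_div_mul_cancel hK', one_mul, sub_sub_cancel]
    simp only [h6]
    rw [hΔ, aggregate, smul_dotProduct, sum_dotProduct, smul_eq_mul]
    rfl
  have h7 := bestDirection_sub_le_expect_truncGain (s ρ) ρ x d.2
  have h8 := opt_le_add_bestDirection hmono hsub hlmo ρ hx
  rw [smul_dotProduct, smul_eq_mul, h5] at h1
  have h9 : S.η * (S.opt M - multilinearExt S.F x - s ρ)
      ≤ S.η * expect S.p (S.truncGain (s ρ) ρ x d.2) :=
    mul_le_mul_of_nonneg_left (by linarith) hη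
  linarith

/-- The recursion for the gap, unrolled on the event that all estimates of active clients are
accurate. -/
theorem opt_sub_le_rounds (h0 : ∀ i, S.f i ∅ = 0) (hmono : ∀ i, Monotone (S.f i))
    (hsub : ∀ i, IsSubmodular (S.f i)) (hlmo : S.IsLinearMaximizer M) (hr : M.eRank = r)
    (hτ : 0 < S.τ) (hK : 0 < S.K) (hη : 0 ≤ S.η) (hηN : S.η * S.rounds ≤ 1) {σ : ℝ}
    (hσ : 0 ≤ σ) {γ L : ℕ → ℝ} (hγ : S.BoundedHeterogeneity γ) (hL : S.LocallyLipschitz L)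
    {ω : S.Draw} (hω : ω ∈ S.runPMF.support) (hacc : ω ∉ S.historyInaccurate σ S.rounds)
    {n : ℕ} (hn : n ≤ S.rounds) :
    S.opt M - multilinearExt S.F (S.serverModel ω n)
      ≤ (1 - S.η) ^ n * S.opt M
        + ∑ ρ ∈ range n, (S.η * (r * (γ ρ + 2 * σ + 2 * L ρ))
            + S.η ^ 2 * r ^ 2 * maxSingleton S.F / 2)
        + S.noiseSum γ (fun ρ => r * (γ ρ + 2 * σ + 2 * L ρ)) ω n := by
  have hmem : ∀ n ≤ S.rounds, S.serverModel ω n ∈ Set.Icc (0 : E → ℝ) 1 := fun n hn =>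
    matroidPolytope_subset_Icc M <| serverModel_mem hmono hlmo hτ hK hη ω <|
      (mul_le_mul_of_nonneg_left (by exact_mod_cast hn) hη).trans hηN
  induction n with
  | zero => simp [serverModel, multilinearExt_zero, F_empty h0, noiseSum]
  | succ n ih =>
    have hn' : n < S.rounds := hn
    have ih := ih hn'.le
    have hη1 : S.η ≤ 1 := by
      refine le_trans (le_mul_of_one_le_right hη ?_) hηN
      exact_mod_cast (Nat.succ_le_of_lt (Nat.zero_lt_of_lt hn'))
    have hsucc : S.serverModel ω (n + 1) = S.serverModel ω n
        + S.η • S.aggregate n (S.serverModel ω n) (ω ⟨n, hn'⟩) := by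
      rw [serverModel, dif_pos hn']
    have hc : ∀ ρ < S.rounds, S.HeterogeneityAt (γ ρ) (S.serverModel ω ρ) := fun ρ hρ i =>
      hγ ω hω ⟨ρ, hρ⟩ i
    have hround := opt_sub_le_round h0 hmono hsub hlmo hr hτ hK hη (γ := γ)
      (s := fun ρ => r * (γ ρ + 2 * σ + 2 * L ρ)) n (d := ω ⟨n, hn'⟩) (hmem n hn'.le)
      (hsucc ▸ hmem (n + 1) hn) (hc n hn') (fun k => by
        refine bestDirection_sub_le_gain hmono hlmo hr hτ hσ (hL.1 n) n (hmem n hn'.le) (hc n hn')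
          _ _ (fun h => hacc ⟨⟨n, hn'⟩, k, h⟩) fun j hj => ?_
        exact hL.2 ω hω ⟨n, hn'⟩ _ j hj)
    have herr : 0 ≤ ∑ ρ ∈ range n, (S.η * (r * (γ ρ + 2 * σ + 2 * L ρ))
        + S.η ^ 2 * r ^ 2 * maxSingleton S.F / 2) := by
      refine sum_nonneg fun ρ hρ => ?_
      have h1 := (hc ρ ((mem_range.1 hρ).trans hn')).nonneg
      have h2 := hL.1 ρ
      have h3 := maxSingleton_nonneg (F_empty h0) (F_monotone hmono)
      positivity
    rw [noiseSum, dif_pos hn', hsucc, sum_range_succ, pow_succ']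
    have h4 := mul_le_mul_of_nonneg_left ih (sub_nonneg.2 hη1)
    have h5 := mul_nonneg hη herr
    linarith

end Input

/-! ### The bound that holds with high probability -/

theorem sum_add_sq_le {κ : Type*} (s : Finset κ) {u : κ → ℝ} (hu : ∀ k ∈ s, 0 ≤ u k) {c : ℝ}
    (hc : 0 ≤ c) : ∑ k ∈ s, (u k + c) ^ 2 ≤ (∑ k ∈ s, u k + c * Real.sqrt #s) ^ 2 := by
  rcases s.eq_empty_or_nonempty with rfl | hs
  · simp
  have h1 : ∑ k ∈ s, u k ^ 2 ≤ (∑ k ∈ s, u k) ^ 2 :=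
    sum_sq_le_sq_sum_of_nonneg hu
  have h2 : 1 ≤ Real.sqrt #s := Real.one_le_sqrt.2 (by exact_mod_cast hs.card_pos)
  have h3 : ∑ k ∈ s, (u k + c) ^ 2 = ∑ k ∈ s, u k ^ 2 + 2 * c * ∑ k ∈ s, u k + #s * c ^ 2 := by
    simp only [add_sq, sum_add_distrib, sum_const, nsmul_eq_mul, mul_sum]
    congr 2
    exact sum_congr rfl fun _ _ => by ring
  have h4 := mul_le_mul_of_nonneg_left h2 (mul_nonneg hc (sum_nonneg hu))
  have h5 := Real.sq_sqrt (Nat.cast_nonneg (α := ℝ) #s)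
  rw [h3, add_sq, mul_pow, h5]
  linarith

namespace Input

variable {E ι : Type*} [Fintype E] [DecidableEq E] [Fintype ι] [DecidableEq ι]
  {S : Input E ι} {M : Matroid E} {r : ℕ}

theorem BoundedHeterogeneity.nonneg {γ : ℕ → ℝ} (h : S.BoundedHeterogeneity γ) {t : ℕ}
    (ht : t < S.rounds) : 0 ≤ γ t := by
  obtain ⟨ω, hω⟩ := S.runPMF.support_nonempty
  exact (norm_nonneg _).trans (h ω hω ⟨t, ht⟩ S.p.support_nonempty.some)

/-- In rank `0` the polytope is a point, so every point of it is optimal. -/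
theorem opt_le_of_rank_zero (hr : M.eRank = (0 : ℕ)) {x : E → ℝ} (hx : x ∈ matroidPolytope M) :
    S.opt M ≤ multilinearExt S.F x := by
  have hzero : ∀ w ∈ matroidPolytope M, w = 0 := by
    intro w hw
    have h0 := (matroidPolytope_subset_Icc M hw).1
    have h1 := sum_le_of_mem_matroidPolytope hr hw
    rw [Nat.cast_zero] at h1
    funext e
    exact (sum_eq_zero_iff_of_nonneg fun i _ => h0 i).1
      (le_antisymm h1 (sum_nonneg fun i _ => h0 i)) e (mem_univ e)
  refine csSup_le (Set.Nonempty.image _ ⟨x, hx⟩) ?_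
  rintro _ ⟨w, hw, rfl⟩
  rw [hzero w hw, hzero x hx]

/-- The bound with explicit constants. The bad event costs `δ / 2`, and Chebyshev's inequality for
the sampling noise costs at most another `δ / 2`. -/
theorem one_sub_le_prob_opt_le (h0 : ∀ i, S.f i ∅ = 0) (hmono : ∀ i, Monotone (S.f i))
    (hsub : ∀ i, IsSubmodular (S.f i)) (hlmo : S.IsLinearMaximizer M) (hr : M.eRank = r)
    (hτ : 0 < S.τ) (hK : 0 < S.K) (hη : 0 < S.η) (hN : 0 < S.rounds)
    (hηN : S.η * S.rounds ≤ 1) {σ δ : ℝ} (hσ : 0 < σ) (hδ : 0 < δ) {γ L : ℕ → ℝ}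
    (hγ : S.BoundedHeterogeneity γ) (hL : S.LocallyLipschitz L)
    (hbad : prob S.runPMF (S.historyInaccurate σ S.rounds) ≤ δ / 2) :
    1 - δ ≤ prob S.runPMF {ω | (1 - (1 - S.η) ^ S.rounds) * S.opt M
      ≤ multilinearExt S.F (S.output ω)
        + S.rounds * (S.η ^ 2 * r ^ 2 * maxSingleton S.F / 2)
        + S.η * r * (∑ t ∈ range S.rounds, γ t + 2 * σ * S.rounds + 2 * ∑ t ∈ range S.rounds, L t)
        + 2 * S.η * r * (∑ t ∈ range S.rounds, γ t + ∑ t ∈ range S.rounds, L t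
            + σ * Real.sqrt S.rounds) / Real.sqrt (S.K * δ)} := by
  set N := S.rounds with hNdef
  set D := ∑ t ∈ range N, γ t with hD
  set Q := ∑ t ∈ range N, L t with hQ
  set b := 2 * S.η * r * (D + Q + σ * Real.sqrt N) / Real.sqrt (S.K * δ) with hb
  have hN1 : (1 : ℝ) ≤ N := by exact_mod_cast hN
  have hη1 : S.η ≤ 1 := (le_mul_of_one_le_right hη.le hN1).trans hηN
  have hK' : (0 : ℝ) < S.K := by exact_mod_cast hK
  have hγ0 : ∀ t ∈ range N, 0 ≤ γ t := fun t ht => hγ.nonneg (mem_range.1 ht)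
  have hD0 : 0 ≤ D := sum_nonneg hγ0
  have hQ0 : 0 ≤ Q := sum_nonneg fun t _ => hL.1 t
  have hm0 := maxSingleton_nonneg (F_empty h0) (F_monotone hmono)
  set good : Set S.Draw := {ω | (1 - (1 - S.η) ^ N) * S.opt M
      ≤ multilinearExt S.F (S.output ω) + N * (S.η ^ 2 * r ^ 2 * maxSingleton S.F / 2)
        + S.η * r * (D + 2 * σ * N + 2 * Q) + b} with hgood
  -- Chebyshev's inequality needs the threshold `b` to be positive, which fails only for `r = 0`.
  rcases Nat.eq_zero_or_pos r with hr0 | hr0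
  · have hall : ∀ ω, ω ∈ good := by
      intro ω
      have h1 := opt_le_of_rank_zero (S := S) (hr0 ▸ hr)
        (serverModel_mem hmono hlmo hτ hK hη.le ω (j := N) hηN)
      have h2 : 0 ≤ (1 - S.η) ^ N * S.opt M :=
        mul_nonneg (pow_nonneg (by linarith) _) (opt_nonneg h0 hmono M)
      have h3 : (1 - (1 - S.η) ^ N) * S.opt M ≤ multilinearExt S.F (S.output ω) := by
        rw [sub_mul, one_mul]
        exact (sub_le_self _ h2).trans h1
      rw [hgood, Set.mem_ofPred_eq, hb, hr0]
      simpa using h3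
    have h1 : prob S.runPMF good = 1 := by
      rw [prob, Set.eq_univ_of_forall hall, Set.indicator_univ]
      exact expect_const _ 1
    linarith
  have hb0 : 0 < b := by positivity
  set s : ℕ → ℝ := fun ρ => r * (γ ρ + 2 * σ + 2 * L ρ) with hs
  -- Outside the good event, either an estimate is inaccurate or the noise exceeds `b`.
  have hpt : ∀ ω ∈ S.runPMF.support,
      1 - ((S.historyInaccurate σ N).indicator 1 ω + 1 / b ^ 2 * S.noiseSum γ s ω N ^ 2)
        ≤ good.indicator (1 : S.Draw → ℝ) ω := by
    intro ω hω
    have hZ : 0 ≤ 1 / b ^ 2 * S.noiseSum γ s ω N ^ 2 := by positivity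
    by_cases hacc : ω ∈ S.historyInaccurate σ N
    · have := indicator_one_nonneg good ω
      rw [Set.indicator_of_mem hacc, Pi.one_apply]
      linarith
    rw [Set.indicator_of_notMem hacc]
    by_cases hg : ω ∈ good
    · rw [Set.indicator_of_mem hg, Pi.one_apply]
      linarith
    rw [Set.indicator_of_notMem hg]
    have hmain := opt_sub_le_rounds h0 hmono hsub hlmo hr hτ hK hη.le hηN hσ.le hγ hL hω hacc
      (le_refl N)
    have hsum : ∑ ρ ∈ range N, (S.η * (r * (γ ρ + 2 * σ + 2 * L ρ))
        + S.η ^ 2 * r ^ 2 * maxSingleton S.F / 2)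
        = S.η * r * (D + 2 * σ * N + 2 * Q)
          + N * (S.η ^ 2 * r ^ 2 * maxSingleton S.F / 2) := by
      rw [sum_add_distrib, ← mul_sum, ← mul_sum, sum_add_distrib, sum_add_distrib, ← mul_sum,
        ← mul_sum, sum_const, sum_const, card_range, nsmul_eq_mul, nsmul_eq_mul, ← hD, ← hQ]
      ring
    have hlt : b ≤ S.noiseSum γ s ω N := by
      rw [hsum] at hmain
      rw [hgood, Set.mem_ofPred_eq, not_le] at hg
      have hout : S.output ω = S.serverModel ω N := rfl
      rw [hout] at hg
      linarith
    have hsq : b ^ 2 ≤ S.noiseSum γ s ω N ^ 2 := pow_le_pow_left₀ hb0.le hlt 2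
    have : 1 ≤ 1 / b ^ 2 * S.noiseSum γ s ω N ^ 2 := by
      rw [one_div_mul_eq_div, one_le_div (by positivity)]
      exact hsq
    linarith
  have hvar : 1 / b ^ 2 * expect S.runPMF (fun ω => S.noiseSum γ s ω N ^ 2) ≤ δ / 2 := by
    have h1 := expect_noiseSum_sq_le hmono hlmo hr hτ hK hη.le hη1 (γ := γ) (s := s)
      (fun ρ => mul_le_mul_of_nonneg_left (by linarith [hL.1 ρ]) (Nat.cast_nonneg r)) hηN
    have h2 : ∑ ρ ∈ range N, S.η ^ 2 * ((r * γ ρ + s ρ) ^ 2 / (4 * S.K))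
        = S.η ^ 2 * r ^ 2 / S.K * ∑ ρ ∈ range N, ((γ ρ + L ρ) + σ) ^ 2 := by
      rw [mul_sum]
      refine sum_congr rfl fun ρ _ => ?_
      rw [hs]
      field_simp
      ring
    have h3 := sum_add_sq_le (range N) (u := fun ρ => γ ρ + L ρ)
      (fun ρ hρ => add_nonneg (hγ0 ρ hρ) (hL.1 ρ)) hσ.le
    rw [sum_add_distrib, card_range] at h3
    have h4 : S.η ^ 2 * r ^ 2 / S.K * (D + Q + σ * Real.sqrt N) ^ 2 = b ^ 2 * (δ / 4) := by
      rw [hb, div_pow, Real.sq_sqrt (by positivity)]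
      field_simp
      ring
    have h5 : S.η ^ 2 * r ^ 2 / S.K * ∑ ρ ∈ range N, ((γ ρ + L ρ) + σ) ^ 2 ≤ b ^ 2 * (δ / 4) :=
      (mul_le_mul_of_nonneg_left h3 (by positivity)).trans_eq h4
    rw [one_div_mul_eq_div, div_le_iff₀ (by positivity)]
    have h6 : 0 ≤ b ^ 2 * δ := by positivity
    calc expect S.runPMF (fun ω => S.noiseSum γ s ω N ^ 2)
        ≤ b ^ 2 * (δ / 4) := (h1.trans_eq h2).trans h5
      _ ≤ δ / 2 * b ^ 2 := by linarith
  have hfin := expect_mono_support hpt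
  rw [expect_sub, expect_const, expect_add, expect_const_mul] at hfin
  have hbad' : expect S.runPMF ((S.historyInaccurate σ N).indicator 1) ≤ δ / 2 := hbad
  have hfin' : _ ≤ prob S.runPMF good := hfin
  linarith

/-- The union bound over all coordinates of all estimates, for enough samples per estimate. -/
theorem union_bound_le {n T K m : ℕ} (hT : 0 < T) (hK : 0 < K) {b σ δ : ℝ} (hb : 0 < b)
    (hσ : 0 < σ) (hδ : 0 < δ) (hδ1 : δ ≤ 1)
    (hm : 2 * b ^ 2 * (n + 2) * Real.log (2 * T * K / δ) / σ ^ 2 ≤ m) :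
    T * K * (2 * n * Real.exp (-(m * σ ^ 2 / (2 * b ^ 2)))) ≤ δ / 2 := by
  have hT' : (1 : ℝ) ≤ T := by exact_mod_cast hT
  have hK' : (1 : ℝ) ≤ K := by exact_mod_cast hK
  set a := 2 * T * K / δ with ha
  have hTK : (1 : ℝ) ≤ T * K := one_le_mul_of_one_le_of_one_le hT' hK'
  have ha2 : 2 ≤ a := by
    rw [ha, le_div_iff₀ hδ]
    linarith
  have ha0 : 0 < a := by linarith
  have h1 : (n + 2 : ℕ) * Real.log a ≤ m * σ ^ 2 / (2 * b ^ 2) := by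
    rw [div_le_iff₀ (by positivity)] at hm
    rw [le_div_iff₀ (by positivity)]
    push_cast
    linarith
  have h2 : Real.exp (-(m * σ ^ 2 / (2 * b ^ 2))) ≤ 1 / a ^ (n + 2) := by
    refine (Real.exp_le_exp.2 (neg_le_neg h1)).trans_eq ?_
    rw [Real.exp_neg, Real.exp_nat_mul, Real.exp_log ha0, one_div]
  have h3 : 2 * (n : ℝ) ≤ a ^ (n + 1) := by
    have h4 : (n : ℝ) ≤ 2 ^ n := by exact_mod_cast Nat.lt_two_pow_self.le
    have h5 : (2 : ℝ) ^ (n + 1) ≤ a ^ (n + 1) := pow_le_pow_left₀ (by norm_num) ha2 _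
    rw [pow_succ] at h5
    linarith
  have h6 : (T : ℝ) * K = δ * a / 2 := by
    rw [ha]
    field_simp
  calc (T : ℝ) * K * (2 * n * Real.exp (-(m * σ ^ 2 / (2 * b ^ 2))))
      ≤ T * K * (2 * n * (1 / a ^ (n + 2))) := by gcongr
    _ ≤ T * K * (a ^ (n + 1) * (1 / a ^ (n + 2))) := by gcongr
    _ = δ / 2 := by
      rw [h6, pow_succ a (n + 1)]
      field_simp

theorem prob_historyInaccurate_le_half {n : ℕ} (hn : Fintype.card E = n) (h0 : ∀ i, S.f i ∅ = 0)
    (hmono : ∀ i, Monotone (S.f i)) (hsub : ∀ i, IsSubmodular (S.f i)) {b : ℝ} (hb : 0 < b)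
    (hfb : ∀ i e, S.f i {e} ≤ b) (hT : 0 < S.T) (hτT : S.τ ∣ S.T) (hK : 0 < S.K) {σ δ : ℝ}
    (hσ : 0 < σ) (hδ : 0 < δ) (hδ1 : δ ≤ 1)
    (hm : 2 * b ^ 2 * (n + 2) * Real.log (2 * S.T * S.K / δ) / σ ^ 2 ≤ S.m) :
    prob S.runPMF (S.historyInaccurate σ S.rounds) ≤ δ / 2 := by
  refine (prob_historyInaccurate_le (fun i y => prob_inaccurate_le (h0 i) (hmono i) (hsub i) hb
    (hfb i) hσ S.m y) S.rounds).trans ?_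
  refine le_trans (le_of_eq ?_) (union_bound_le hT hK hb hσ hδ hδ1 hm)
  have h : (S.T : ℝ) = S.rounds * S.τ := by
    exact_mod_cast (Nat.div_mul_cancel hτT).symm
  rw [h, hn]
  ring

end Input

/-! ### Communication -/

section Codes

variable {E : Type*} [Fintype E]

/-- The vectors whose coordinates are natural numbers up to `c`. -/
def IsCount (c : ℕ) (u : E → ℝ) : Prop := ∃ a : E → ℕ, (∀ e, a e ≤ c) ∧ u = fun e => (a e : ℝ)

theorem IsCount.mono {c c' : ℕ} {u : E → ℝ} (h : IsCount c u) (hc : c ≤ c') : IsCount c' u := by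
  obtain ⟨a, ha, rfl⟩ := h
  exact ⟨a, fun e => (ha e).trans hc, rfl⟩

theorem IsCount.sum {κ : Type*} (s : Finset κ) {c : ℕ} {u : κ → E → ℝ}
    (h : ∀ k, IsCount c (u k)) : IsCount (#s * c) (∑ k ∈ s, u k) := by
  choose a ha hu using h
  refine ⟨fun e => ∑ k ∈ s, a k e, fun e => ?_, ?_⟩
  · exact (sum_le_card_nsmul s _ c fun k _ => ha k e).trans_eq (smul_eq_mul _ _)
  · funext e
    simp [hu]

theorem isCount_indicator (I : Set E) : IsCount 1 (I.indicator (1 : E → ℝ)) := by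
  classical
  refine ⟨fun e => if e ∈ I then 1 else 0, fun e => ?_, ?_⟩
  · by_cases h : e ∈ I <;> simp [h]
  · funext e
    simp [Set.indicator_apply]

/-- Multiples `k • u` of count vectors have a code with words of a fixed length, which is
prefix-free since it is injective. -/
theorem exists_prefixCode (X : Set (E → ℝ)) {c : ℕ} {k : ℝ}
    (hX : ∀ x ∈ X, ∃ u, IsCount c u ∧ x = k • u) :
    ∃ enc : (E → ℝ) → List Bool, Input.IsPrefixCode X enc ∧
      ∀ x, (enc x).length = Fintype.card E * Nat.clog 2 (c + 1) := by
  classical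
  set l := Fintype.card E * Nat.clog 2 (c + 1)
  have hcard : Fintype.card (E → Fin (c + 1)) ≤ Fintype.card (Fin l → Bool) := by
    rw [Fintype.card_fun, Fintype.card_fun, Fintype.card_fin, Fintype.card_fin, Fintype.card_bool,
      show l = Nat.clog 2 (c + 1) * Fintype.card E from mul_comm _ _, pow_mul]
    exact Nat.pow_le_pow_left (Nat.le_pow_clog one_lt_two _) _
  obtain ⟨φ⟩ := Function.Embedding.nonempty_of_card_le hcard
  have hX' : ∀ x, x ∈ X → ∃ a : E → Fin (c + 1), x = fun e => k * (a e : ℕ) := by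
    intro x hx
    obtain ⟨_, ⟨a, ha, rfl⟩, rfl⟩ := hX x hx
    exact ⟨fun e => ⟨a e, Nat.lt_succ_of_le (ha e)⟩, rfl⟩
  choose! a ha using hX'
  refine ⟨fun x => List.ofFn (φ (a x)), fun u hu v hv huv => ?_, fun x => List.length_ofFn⟩
  have h1 := List.ofFn_injective (huv.eq_of_length (by simp))
  rw [ha u hu, ha v hv, φ.injective h1]

end Codes

namespace Input

variable {E ι : Type*} [Fintype E] [DecidableEq E] [Fintype ι] [DecidableEq ι]
  {S : Input E ι} {M : Matroid E}

theorem isCount_sum_direction (hmono : ∀ i, Monotone (S.f i)) (hv : S.ReturnsVertices M) (ρ : ℕ)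
    (i : ι) {n : ℕ} (ζ : Fin n → Fin S.m → Finset E) (j : ℕ) :
    IsCount j (∑ l ∈ range j, S.direction ρ i ζ l) := by
  have h := IsCount.sum (range j) (c := 1) (u := S.direction ρ i ζ) fun l => by
    rw [direction]
    split_ifs
    · obtain ⟨I, -, hI⟩ := hv ρ i l _ (gradEst_nonneg (hmono i) (ζ ⟨l, _⟩))
      rw [hI]
      exact isCount_indicator I
    · exact ⟨0, fun _ => zero_le_one, by funext; simp⟩
  rwa [card_range, mul_one] at h

theorem localChange_eq (ρ : ℕ) (i : ι) (x : E → ℝ) (d : S.RoundDraw) :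
    S.localChange ρ i x d
      = (1 / (S.τ : ℝ)) • ∑ l ∈ range S.τ, S.direction ρ i (d.2 i) l := by
  rw [localChange, localModel_eq, localModel, add_sub_cancel_left]

theorem exists_isCount_serverModel (hmono : ∀ i, Monotone (S.f i)) (hv : S.ReturnsVertices M)
    {n : ℕ} (ω : Fin n → S.RoundDraw) (j : ℕ) :
    ∃ u, IsCount (j * (S.K * S.τ)) u ∧
      S.serverModel ω j = (S.η * (1 / (S.K : ℝ) * (1 / (S.τ : ℝ)))) • u := by
  have h : ∀ ρ : ℕ, ∃ u, IsCount (S.K * S.τ) u ∧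
      (if h : ρ < n then S.aggregate ρ (S.serverModel ω ρ) (ω ⟨ρ, h⟩) else 0)
        = (1 / (S.K : ℝ) * (1 / (S.τ : ℝ))) • u := by
    intro ρ
    split_ifs with hρ
    · have h1 := IsCount.sum (univ : Finset (Fin S.K)) (c := S.τ) fun k =>
        isCount_sum_direction hmono hv ρ ((ω ⟨ρ, hρ⟩).1 k)
          ((ω ⟨ρ, hρ⟩).2 ((ω ⟨ρ, hρ⟩).1 k)) S.τ
      rw [card_univ, Fintype.card_fin] at h1
      refine ⟨_, h1, ?_⟩
      rw [aggregate]
      simp only [localChange_eq]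
      rw [← smul_sum, smul_smul]
    · exact ⟨0, ⟨0, fun _ => Nat.zero_le _, by funext; simp⟩, by simp⟩
  choose u hu hu' using h
  refine ⟨∑ ρ ∈ range j, u ρ, ?_, ?_⟩
  · simpa using IsCount.sum (range j) hu
  · rw [serverModel_eq]
    simp only [hu']
    rw [← smul_sum, smul_smul]

theorem exists_codes (hmono : ∀ i, Monotone (S.f i)) (hτT : S.τ ∣ S.T)
    (hv : S.ReturnsVertices M) :
    ∃ down up : (E → ℝ) → List Bool,
      IsPrefixCode {x | ∃ ω ρ, x = S.serverModel (ω : S.Draw) (ρ : Fin S.rounds)} down ∧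
      IsPrefixCode {v | ∃ ω ρ i, v = S.message (ω : S.Draw) ρ i} up ∧
      (∀ x, (down x).length = Fintype.card E * Nat.clog 2 (S.T * S.K + 1)) ∧
      ∀ x, (up x).length = Fintype.card E * Nat.clog 2 (S.τ + 1) := by
  obtain ⟨down, hd, hd'⟩ := exists_prefixCode
    {x | ∃ ω ρ, x = S.serverModel (ω : S.Draw) (ρ : Fin S.rounds)} (c := S.T * S.K)
    (k := S.η * (1 / (S.K : ℝ) * (1 / (S.τ : ℝ)))) (by
      rintro _ ⟨ω, ρ, rfl⟩
      obtain ⟨u, hu, hu'⟩ := exists_isCount_serverModel hmono hv ω ρ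
      refine ⟨u, hu.mono ?_, hu'⟩
      calc (ρ : ℕ) * (S.K * S.τ) ≤ S.rounds * (S.K * S.τ) := Nat.mul_le_mul_right _ ρ.2.le
        _ = S.rounds * S.τ * S.K := by ring
        _ = S.T * S.K := by rw [rounds, Nat.div_mul_cancel hτT])
  obtain ⟨up, hu, hu'⟩ := exists_prefixCode
    {v | ∃ ω ρ i, v = S.message (ω : S.Draw) ρ i} (c := S.τ) (k := 1 / (S.τ : ℝ)) (by
      rintro _ ⟨ω, ρ, i, rfl⟩
      exact ⟨_, isCount_sum_direction hmono hv ρ i ((ω ρ).2 i) S.τ, localChange_eq ρ i _ _⟩)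
  exact ⟨down, up, hd, hu, hd', hu'⟩

/-- At most `K` clients are active in a round. -/
theorem sum_bits_le {down up : (E → ℝ) → List Bool} {b : ℕ} (ω : S.Draw)
    (hb : ∀ ρ i, S.bits down up ω ρ i ≤ b) :
    ∑ ρ, ∑ i, S.bits down up ω ρ i ≤ S.K * (S.T / S.τ) * b := by
  have hround : ∀ ρ, ∑ i, S.bits down up ω ρ i ≤ S.K * b := by
    intro ρ
    have h1 : ∑ i, S.bits down up ω ρ i
        = ∑ i ∈ univ.image (ω ρ).1, S.bits down up ω ρ i := by
      refine (sum_subset (subset_univ _) fun i _ hi => if_neg ?_).symm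
      rintro ⟨k, hk⟩
      exact hi (mem_image.2 ⟨k, mem_univ k, hk⟩)
    rw [h1]
    refine (sum_le_card_nsmul _ _ b fun i _ => hb ρ i).trans ?_
    rw [smul_eq_mul]
    exact Nat.mul_le_mul_right b (card_image_le.trans (by simp))
  refine (sum_le_sum fun ρ _ => hround ρ).trans_eq ?_
  rw [sum_const, card_univ, Fintype.card_fin, smul_eq_mul, rounds]
  ring

end Input

end FedCG

theorem theorem4p3 (n : ℕ) (B : ℝ) :
    ∃ C : ℝ, 0 < C ∧
    ∀ {E ι : Type*} [Fintype E] [DecidableEq E] [Fintype ι] [DecidableEq ι]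
      (M : Matroid E) (r : ℕ) (S : FedCG.Input E ι) (σ δ : ℝ) (γ L : ℕ → ℝ),
      -- the ground set and the matroid
      Fintype.card E = n → M.E = Set.univ → M.eRank = r →
      -- the clients' functions
      (∀ i, S.f i ∅ = 0) → (∀ i, Monotone (S.f i)) → (∀ i, FedCG.IsSubmodular (S.f i)) →
      (∀ i e, S.f i {e} ≤ B) →
      -- the parameters of the algorithm
      0 < S.τ → 0 < S.T → S.τ ∣ S.T → 0 < S.K → 0 < σ → 0 < δ →
      0 < S.η → S.η ≤ (S.τ : ℝ) / S.T →
      C * Real.log (2 * S.T * S.K / δ) / σ ^ 2 ≤ S.m →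
      S.IsLinearMaximizer M →
      -- heterogeneity and local Lipschitz constants
      S.BoundedHeterogeneity γ → S.LocallyLipschitz L →
      -- the output is feasible
      (∀ ω : S.Draw, S.output ω ∈ FedCG.matroidPolytope M) ∧
      -- the guarantee for a general learning rate
      ENNReal.ofReal (1 - δ) ≤ S.runPMF.toOuterMeasure {ω |
        (1 - (1 - S.η) ^ (S.T / S.τ)) * S.opt M ≤
          FedCG.multilinearExt S.F (S.output ω)
          + S.T * S.η ^ 2 * r ^ 2 * FedCG.maxSingleton S.F / (2 * S.τ)
          + (S.η * r * ∑ t ∈ Finset.range (S.T / S.τ), γ t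
            + (2 * σ * r
              + 2 * S.η * (r : ℝ) ^ (3 / 2 : ℝ) * ∑ t ∈ Finset.range (S.T / S.τ), L t)
            + Real.sqrt S.T
              * (6 * S.η * r * ∑ t ∈ Finset.range (S.T / S.τ), γ t + 2 * σ * r
                + 2 * S.η * (r : ℝ) ^ (3 / 2 : ℝ) * ∑ t ∈ Finset.range (S.T / S.τ), L t)
              / Real.sqrt (S.K * S.τ * δ))} ∧
      -- the guarantee for the learning rate `τ / T`
      (S.η = (S.τ : ℝ) / S.T → ∀ D Q : ℝ,
        D = ∑ t ∈ Finset.range (S.T / S.τ), γ t → Q = ∑ t ∈ Finset.range (S.T / S.τ), L t →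
        ENNReal.ofReal (1 - δ) ≤ S.runPMF.toOuterMeasure {ω |
          (1 - 1 / Real.exp 1) * S.opt M ≤
            FedCG.multilinearExt S.F (S.output ω)
            + S.τ * r ^ 2 * FedCG.maxSingleton S.F / (2 * S.T)
            + r * D * S.τ / S.T
            + 2 * σ * r * (1 + Real.sqrt S.τ / Real.sqrt (S.K * S.T * δ))
            + 2 * (r : ℝ) ^ (3 / 2 : ℝ) * Q * S.τ / S.T
            + Real.sqrt S.τ * (6 * D * r + 2 * (r : ℝ) ^ (3 / 2 : ℝ) * Q)
              / Real.sqrt (S.T * S.K * δ)}) ∧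
      -- the communication
      (S.ReturnsVertices M →
        ∃ down up : (E → ℝ) → List Bool,
          FedCG.Input.IsPrefixCode {x | ∃ ω ρ, x = S.serverModel (ω : S.Draw) (ρ : Fin S.rounds)}
            down ∧
          FedCG.Input.IsPrefixCode {v | ∃ ω ρ i, v = S.message (ω : S.Draw) ρ i} up ∧
          (∀ ω ρ i, S.bits down up ω ρ i ≤
            n * (Nat.clog 2 (S.τ + 1) + Nat.clog 2 (S.T * S.K + 1))) ∧
          ∀ ω, ∑ ρ, ∑ i, S.bits down up ω ρ i ≤
            S.K * (S.T / S.τ) *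
              (n * (Nat.clog 2 (S.τ + 1) + Nat.clog 2 (S.T * S.K + 1)))) := by
  
  classical
  -- `B` may be `0` or, on an empty ground set, negative; Hoeffding's inequality needs a positive
  -- bound.
  set b := |B| + 1
  have hb : 0 < b := by positivity
  refine ⟨2 * b ^ 2 * (n + 2), by positivity, ?_⟩
  intro E ι _ _ _ _ M r S σ δ γ L hn _ hr h0 hmono hsub hB hτ hT hτT hK hσ hδ hη hηT hm hlmo hγ hL
  have hN : 0 < S.rounds := Nat.div_pos (Nat.le_of_dvd hT hτT) hτ
  have hTN : (S.T : ℝ) = S.τ * S.rounds := by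
    exact_mod_cast (Nat.mul_div_cancel' hτT).symm
  have hτ' : (0 : ℝ) < S.τ := by exact_mod_cast hτ
  have hK' : (0 : ℝ) < S.K := by exact_mod_cast hK
  have hN' : (1 : ℝ) ≤ S.rounds := by exact_mod_cast hN
  have hηN : S.η * S.rounds ≤ 1 := by
    rw [hTN, div_mul_cancel_left₀ hτ'.ne'] at hηT
    exact (mul_le_mul_of_nonneg_right hηT (by linarith)).trans_eq (inv_mul_cancel₀ (by linarith))
  have hm0 := FedCG.maxSingleton_nonneg (FedCG.Input.F_empty h0) (FedCG.Input.F_monotone hmono)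
  have hopt := FedCG.Input.opt_nonneg (S := S) h0 hmono M
  have hγ0 : 0 ≤ ∑ t ∈ Finset.range S.rounds, γ t :=
    Finset.sum_nonneg fun t ht => hγ.nonneg (Finset.mem_range.1 ht)
  have hL0 : 0 ≤ ∑ t ∈ Finset.range S.rounds, L t := Finset.sum_nonneg fun t _ => hL.1 t
  have hr32 : (r : ℝ) ≤ (r : ℝ) ^ (3 / 2 : ℝ) := by
    rcases Nat.eq_zero_or_pos r with rfl | hr0
    · rw [Nat.cast_zero, Real.zero_rpow (by norm_num)]
    · calc (r : ℝ) = (r : ℝ) ^ (1 : ℝ) := (Real.rpow_one _).symm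
        _ ≤ (r : ℝ) ^ (3 / 2 : ℝ) :=
          Real.rpow_le_rpow_of_exponent_le (by exact_mod_cast hr0) (by norm_num)
  -- Both guarantees follow from this one event. The second is not a special case of the first: its
  -- `σ` term is smaller by the factor `τ / T`.
  have hprob : δ ≤ 1 → _ := fun hδ1 => FedCG.Input.one_sub_le_prob_opt_le h0 hmono hsub hlmo hr hτ
    hK hη hN hηN hσ hδ hγ hL (FedCG.Input.prob_historyInaccurate_le_half hn h0 hmono hsub hb
      (fun i e => (hB i e).trans (by linarith [le_abs_self B])) hT hτT hK hσ hδ hδ1 hm)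
  have hrounds : S.T / S.τ = S.rounds := rfl
  rw [hrounds]
  set D := ∑ t ∈ Finset.range S.rounds, γ t
  set Q := ∑ t ∈ Finset.range S.rounds, L t
  set R := (r : ℝ) ^ (3 / 2 : ℝ)
  set N : ℝ := (S.rounds : ℝ) with hNdef
  have hr0 : (0 : ℝ) ≤ r := Nat.cast_nonneg r
  have hRQ : r * Q ≤ R * Q := mul_le_mul_of_nonneg_right hr32 hL0
  set κ := Real.sqrt (S.K * δ) with hκdef
  have hκ : 0 < κ := Real.sqrt_pos.2 (by positivity)
  set u := Real.sqrt N with hu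
  have hu1 : 1 ≤ u := Real.one_le_sqrt.2 hN'
  have huN : u * u = N := Real.mul_self_sqrt (by linarith)
  have hsτ : 0 < Real.sqrt S.τ := Real.sqrt_pos.2 hτ'
  have hsT : Real.sqrt S.T = Real.sqrt S.τ * u := by rw [hTN, Real.sqrt_mul hτ'.le]
  refine ⟨fun ω => FedCG.Input.serverModel_mem hmono hlmo hτ hK hη.le ω hηN, ?_, ?_, ?_⟩
  · rcases le_total δ 1 with hδ1 | hδ1
    swap
    · rw [ENNReal.ofReal_of_nonpos (by linarith)]
      exact zero_le
    refine FedCG.ofReal_le_toOuterMeasure _ _ ((hprob hδ1).trans (FedCG.prob_mono _ ?_))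
    intro ω hω
    refine le_trans (Set.mem_ofPred_eq ▸ hω) ?_
    have e1 : S.T * S.η ^ 2 * r ^ 2 * FedCG.maxSingleton S.F / (2 * S.τ)
        = N * (S.η ^ 2 * r ^ 2 * FedCG.maxSingleton S.F / 2) := by
      rw [hTN]
      field_simp
    have e2 : Real.sqrt S.T * (6 * S.η * r * D + 2 * σ * r + 2 * S.η * R * Q)
        / Real.sqrt (S.K * S.τ * δ)
        = u * (6 * S.η * r * D + 2 * σ * r + 2 * S.η * R * Q) / κ := by
      rw [hsT, show (S.K : ℝ) * S.τ * δ = S.τ * (S.K * δ) by ring, Real.sqrt_mul hτ'.le, ← hκdef]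
      field_simp
    rw [e1, e2]
    have i1 : S.η * r * (D + 2 * σ * N + 2 * Q)
        ≤ S.η * r * D + (2 * σ * r + 2 * S.η * R * Q) := by
      have a1 := mul_le_mul_of_nonneg_left hηN (show 0 ≤ 2 * σ * r by positivity)
      have a2 := mul_le_mul_of_nonneg_left hRQ hη.le
      linarith
    have i2 : 2 * S.η * r * (D + Q + σ * u) / κ
        ≤ u * (6 * S.η * r * D + 2 * σ * r + 2 * S.η * R * Q) / κ := by
      refine div_le_div_of_nonneg_right ?_ hκ.le
      have hη1 : S.η ≤ 1 := (le_mul_of_one_le_right hη.le hN').trans hηN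
      have a1 : S.η * (r * D) ≤ u * (S.η * (r * D)) := le_mul_of_one_le_left (by positivity) hu1
      have a2 : S.η * (r * Q) ≤ u * (S.η * (R * Q)) :=
        (mul_le_mul_of_nonneg_left hRQ hη.le).trans
          (le_mul_of_one_le_left (mul_nonneg hη.le ((mul_nonneg hr0 hL0).trans hRQ)) hu1)
      have a3 : S.η * (r * σ * u) ≤ 1 * (r * σ * u) :=
        mul_le_mul_of_nonneg_right hη1 (by positivity)
      have a4 : 0 ≤ u * (S.η * (r * D)) := by positivity
      linarith
    linarith
  · intro hηeq D' Q' hD' hQ'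
    rw [hD', hQ']
    rcases le_total δ 1 with hδ1 | hδ1
    swap
    · rw [ENNReal.ofReal_of_nonpos (by linarith)]
      exact zero_le
    refine FedCG.ofReal_le_toOuterMeasure _ _ ((hprob hδ1).trans (FedCG.prob_mono _ ?_))
    intro ω hω
    have hηN' : S.η = 1 / N := by
      rw [hηeq, hTN]
      field_simp
    have hexp : (1 - 1 / Real.exp 1) * S.opt M ≤ (1 - (1 - S.η) ^ S.rounds) * S.opt M := by
      refine mul_le_mul_of_nonneg_right ?_ hopt
      have := Real.one_sub_div_pow_le_exp_neg (n := S.rounds) (t := 1) hN'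
      rw [Real.exp_neg, ← one_div, ← hNdef, ← hηN'] at this
      linarith
    refine hexp.trans (le_trans (Set.mem_ofPred_eq ▸ hω) ?_)
    have hN0 : 0 < N := by linarith
    have e1 : S.τ * r ^ 2 * FedCG.maxSingleton S.F / (2 * S.T)
        = N * (S.η ^ 2 * r ^ 2 * FedCG.maxSingleton S.F / 2) := by
      rw [hTN, hηN']
      field_simp
    have e2 : r * D * S.τ / S.T = S.η * r * D := by
      rw [hTN, hηN']
      field_simp
    have e3 : Real.sqrt S.τ / Real.sqrt (S.K * S.T * δ) = 1 / (u * κ) := by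
      rw [show (S.K : ℝ) * S.T * δ = S.T * (S.K * δ) by ring, Real.sqrt_mul (Nat.cast_nonneg _),
        hsT, ← hκdef]
      field_simp
    have e4 : 2 * R * Q * S.τ / S.T = 2 * (S.η * (R * Q)) := by
      rw [hTN, hηN']
      field_simp
    have e5 : Real.sqrt S.τ * (6 * D * r + 2 * R * Q) / Real.sqrt (S.T * S.K * δ)
        = (6 * D * r + 2 * R * Q) / (u * κ) := by
      rw [show (S.T : ℝ) * S.K * δ = S.T * (S.K * δ) by ring, Real.sqrt_mul (Nat.cast_nonneg _),
        hsT, ← hκdef]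
      field_simp
    rw [e1, e2, e3, e4, e5]
    have i1 : S.η * r * (D + 2 * σ * N + 2 * Q)
        ≤ S.η * r * D + 2 * σ * r + 2 * (S.η * (R * Q)) := by
      have a1 := mul_le_mul_of_nonneg_left hηN (show 0 ≤ 2 * σ * r by positivity)
      have a2 := mul_le_mul_of_nonneg_left hRQ hη.le
      linarith
    have i2 : 2 * S.η * r * (D + Q + σ * u) / κ
        ≤ 2 * σ * r / (u * κ) + (6 * D * r + 2 * R * Q) / (u * κ) := by
      have hu0 : 0 < u := by linarith
      have hηu : S.η = 1 / (u * u) := by rw [hηN', huN]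
      rw [← add_div, hηu, div_le_div_iff₀ hκ (by positivity)]
      have a1 : r * (D + Q) / u ≤ D * r + R * Q := by
        rw [div_le_iff₀ hu0]
        have a2 : 0 ≤ r * D := by positivity
        have a3 : 0 ≤ r * Q := by positivity
        have a4 := le_mul_of_one_le_right (show 0 ≤ D * r + R * Q by linarith) hu1
        linarith
      have a5 : 2 * (1 / (u * u)) * r * (D + Q + σ * u) * (u * κ)
          = (2 * (r * (D + Q) / u) + 2 * σ * r) * κ := by
        field_simp
      rw [a5]
      refine mul_le_mul_of_nonneg_right ?_ hκ.le
      have a6 : 0 ≤ D * r := by positivity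
      linarith
    have i3 : 2 * σ * r * (1 + 1 / (u * κ)) = 2 * σ * r + 2 * σ * r / (u * κ) := by ring
    rw [i3]
    linarith
  · intro hv
    obtain ⟨down, up, hd, hup, hdl, hul⟩ := FedCG.Input.exists_codes hmono hτT hv
    have hbits : ∀ ω ρ i, S.bits down up ω ρ i
        ≤ n * (Nat.clog 2 (S.τ + 1) + Nat.clog 2 (S.T * S.K + 1)) := by
      intro ω ρ i
      rw [FedCG.Input.bits]
      split_ifs
      · rw [hdl, hul, hn, ← mul_add, add_comm]
      · exact Nat.zero_le _
    exact ⟨down, up, hd, hup, hbits, fun ω => FedCG.Input.sum_bits_le ω (hbits ω)⟩
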